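/- Let $\mathcal H$ be a real Hilbert space, $N\ge 1$, and $F_1,\dots,F_N:\mathcal H\to\mathcal H$ operators such that $F_i$ is Lipschitz with constant $L_i$; put $F=\frac1N\sum_{i=1}^N F_i$ and $\mathrm{Fix}(T)=\{x: T(x)=x\}$. An operator $T$ is called quasi-nonexpansive if $\|T(x)-y\|\le\|x-y\|$ for all $x\in\mathcal H$, $y\in \mathrm{Fix}(T)$. Assume: (1) $\mathcal G=([N],\mathcal E)$ is a strongly connected directed graph; $A=(a_{ij})$ is a row-stochastic and $B=(b_{ij})$ a column-stochastic $N\times N$ matrix with $a_{ii},b_{ii}>0$ and, for $i\ne j$, $a_{ij}>0\iff b_{ij}>0\iff (j,i)\in\mathcal E$; $\pi$ and $\nu$ are the entrywise positive vectors with entries summing to $1$ such that $\pi^\top A=\pi^\top$ and $B\nu=\nu$; put $A_\infty=\mathbf 1\pi^\top$, $B_\infty=\nu\mathbf 1^\top$, $D_\nu=\mathrm{diag}(\nu_1,\dots,\nu_N)$. (2) $F$ is quasi-nonexpansive with $\mathrm{Fix}(F)\ne\emptyset$, and $d_{\mathrm{Fix}(F)}(x)\le\kappa\|F(x)-x\|$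 for all $x\in\mathcal H$, with a constant $\kappa>0$. On $\mathbb R^N$ let $\|x\|$ be the Euclidean norm, $\|x\|_\pi=\sqrt{\sum_i\pi_i x_i^2}$, $\|x\|_\nu=\sqrt{\sum_i x_i^2/\nu_i}$, with the same notation for the induced matrix norms, and let $c_1,\dots,c_4>0$ satisfy $c_1\|x\|\le\|x\|_\pi\le c_2\|x\|$ and $c_3\|x\|_\nu\le\|x\|_\pi\le c_4\|x\|_\nu$ for all $x$. Put $\rho_1=\|A-A_\infty\|_\pi$, $\rho_2=\|B-B_\infty\|_\nu$, $\bar L=\max_i L_i$, $\theta_1=\frac{c_4\|D_\nu^{-1}\|}{N}$, $\theta_2=\frac{c_2\bar L(\sqrt N+1)}{c_1c_3}$, $\theta_3=\rho_1+\bar L$, $\theta_4=\|A-I\|$, fix $\delta\in(0,1)$, and let $$M(\alpha)=\begin{pmatrix}(1-\alpha)\rho_1&\alpha c_2\theta_1&0\\ \theta_2(\alpha\theta_3+\theta_4)&\rho_2+\alpha\theta_1\theta_2&2\alpha c_1\theta_2\\ \frac{\alpha\bar L}{c_1}&\frac{\alpha\sqrt N\theta_1}{c_1}&1-\frac{\delta\alpha}{4\kappa^2}\end{pmatrix}.$$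 Let $0<\alpha<\min\{1-\delta,\alpha_c\}$, where $\alpha_c$ is the smallest positive real root of $\det(I-M(\alpha))=0$ ($\alpha_c=\infty$ if there is none). Suppose in addition that every $F_i$ is quasi-nonexpansive and that $\bigcap_{i=1}^N\mathrm{Fix}(F_i)\neq\emptyset$. Then the DOT iterates $$x_{i,k+1}=\sum_{j=1}^N a_{ij}x_{j,k}+\alpha\Big(\frac{y_{i,k}}{N\nu_i}-\sum_{j=1}^N a_{ij}x_{j,k}\Big),\qquad y_{i,k+1}=\sum_{j=1}^N b_{ij}y_{j,k}+F_i(x_{i,k+1})-F_i(x_{i,k}),$$ with arbitrary $x_{i,0}\in\mathcal H$ and $y_{i,0}=F_i(x_{i,0})$, converge linearly to a common point of $\bigcap_i\mathrm{Fix}(F_i)$: there is $r\in(0,1)$, independent of the initial points, such that for all initial points there are $p\in\bigcap_i\mathrm{Fix}(F_i)$ and a constant $C$ with $\|x_{i,k}-p\|\le C r^k$ for all $i\in[N]$ and $k\ge0$. -/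

import Mathlib

open scoped NNReal Matrix

noncomputable section

namespace DOT

/-- `T` is quasi-nonexpansive: `‖T x - y‖ ≤ ‖x - y‖` for every `x` and every fixed point `y`. -/
def QuasiNonexpansive {H : Type*} [NormedAddCommGroup H] (T : H → H) : Prop :=
  ∀ x : H, ∀ y ∈ Function.fixedPoints T, ‖T x - y‖ ≤ ‖x - y‖

/-- `T` is linearly regular with constant `κ`: `d_{Fix T}(x) ≤ κ ‖T x - x‖` for every `x`. -/
def LinearlyRegularWith {H : Type*} [NormedAddCommGroup H] (κ : ℝ) (T : H → H) : Prop :=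
  ∀ x : H, Metric.infDist x (Function.fixedPoints T) ≤ κ * ‖T x - x‖

/-- The global operator `F = (1/N) ∑ i, F i`. -/
def globalOp {H : Type*} [NormedAddCommGroup H] [InnerProductSpace ℝ H] {N : ℕ}
    (F : Fin N → H → H) : H → H :=
  fun x => (1 / (N : ℝ)) • ∑ i, F i x

/-- Any two nodes are joined by a directed path. -/
def StronglyConnected {V : Type*} (G : Digraph V) : Prop :=
  ∀ i j : V, Relation.ReflTransGen G.Adj i j

/-- `P` has a positive diagonal, and its off-diagonal entry `P i j` is positive exactly when `j` can
send information to `i`. -/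
structure Compatible {N : ℕ} (G : Digraph (Fin N)) (P : Matrix (Fin N) (Fin N) ℝ) : Prop where
  diag_pos : ∀ i, 0 < P i i
  pos_iff : ∀ i j, i ≠ j → (0 < P i j ↔ G.Adj j i)

/-- The communication matrices of a network: the digraph `G` is strongly connected, `A` is
row-stochastic and `B` column-stochastic, both compatible with `G`; `π` is the positive left
stochastic eigenvector of `A` and `ν` the positive right stochastic eigenvector of `B`, for the
eigenvalue `1`. -/
structure IsNetwork {N : ℕ} (G : Digraph (Fin N)) (A B : Matrix (Fin N) (Fin N) ℝ)
    (π ν : Fin N → ℝ) : Prop where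
  strong : StronglyConnected G
  compatA : Compatible G A
  compatB : Compatible G B
  row_stoch : A ∈ Matrix.rowStochastic ℝ (Fin N)
  col_stoch : B ∈ Matrix.colStochastic ℝ (Fin N)
  pi_pos : ∀ i, 0 < π i
  pi_sum : ∑ i, π i = 1
  pi_eig : π ᵥ* A = π
  nu_pos : ∀ i, 0 < ν i
  nu_sum : ∑ i, ν i = 1
  nu_eig : B *ᵥ ν = ν

/-- The infinite power `A_∞ = 1 πᵀ` of `A`. -/
def Ainf {N : ℕ} (π : Fin N → ℝ) : Matrix (Fin N) (Fin N) ℝ := Matrix.of fun _ j => π j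

/-- The infinite power `B_∞ = ν 1ᵀ` of `B`. -/
def Binf {N : ℕ} (ν : Fin N → ℝ) : Matrix (Fin N) (Fin N) ℝ := Matrix.of fun i _ => ν i

/-- `‖x‖_π = √(∑ i, π i * (x i)²)`. -/
def piNorm {N : ℕ} (π x : Fin N → ℝ) : ℝ := √(∑ i, π i * x i ^ 2)

/-- `‖x‖_ν = √(∑ i, (x i)² / ν i)`. -/
def nuNorm {N : ℕ} (ν x : Fin N → ℝ) : ℝ := √(∑ i, x i ^ 2 / ν i)

/-- The norm of a matrix induced by a norm `n` on vectors: the least `c ≥ 0` with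
`n (P x) ≤ c * n x` for all `x`. -/
def inducedNorm {N : ℕ} (n : (Fin N → ℝ) → ℝ) (P : Matrix (Fin N) (Fin N) ℝ) : ℝ :=
  sInf {c : ℝ | 0 ≤ c ∧ ∀ x, n (P *ᵥ x) ≤ c * n x}

/-- The norm of a matrix induced by the Euclidean norm. -/
def l2Norm {N : ℕ} (P : Matrix (Fin N) (Fin N) ℝ) : ℝ := ‖Matrix.toEuclideanCLM (𝕜 := ℝ) P‖

/-- `c₁, c₂, c₃, c₄` are positive constants with `c₁ ‖x‖ ≤ ‖x‖_π ≤ c₂ ‖x‖` and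
`c₃ ‖x‖_ν ≤ ‖x‖_π ≤ c₄ ‖x‖_ν` for all `x`, where `‖x‖` is the Euclidean norm. -/
structure NormConstants {N : ℕ} (π ν : Fin N → ℝ) (c₁ c₂ c₃ c₄ : ℝ) : Prop where
  pos₁ : 0 < c₁
  pos₂ : 0 < c₂
  pos₃ : 0 < c₃
  pos₄ : 0 < c₄
  le₁ : ∀ x : EuclideanSpace ℝ (Fin N), c₁ * ‖x‖ ≤ piNorm π x
  le₂ : ∀ x : EuclideanSpace ℝ (Fin N), piNorm π x ≤ c₂ * ‖x‖
  le₃ : ∀ x : Fin N → ℝ, c₃ * nuNorm ν x ≤ piNorm π x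
  le₄ : ∀ x : Fin N → ℝ, piNorm π x ≤ c₄ * nuNorm ν x

/-- The matrix `M(α)` whose determinant `det (I - M(α))` bounds the admissible stepsizes. -/
def stepMatrix {N : ℕ} (A B : Matrix (Fin N) (Fin N) ℝ) (π ν : Fin N → ℝ) (L : Fin N → ℝ≥0)
    (κ δ c₁ c₂ c₃ c₄ α : ℝ) : Matrix (Fin 3) (Fin 3) ℝ :=
  let ρ₁ : ℝ := inducedNorm (piNorm π) (A - Ainf π)
  let ρ₂ : ℝ := inducedNorm (nuNorm ν) (B - Binf ν)
  let Lbar : ℝ := ((Finset.univ.sup L : ℝ≥0) : ℝ)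
  let θ₁ : ℝ := c₄ * l2Norm ((Matrix.diagonal ν)⁻¹) / N
  let θ₂ : ℝ := c₂ * Lbar * (√N + 1) / (c₁ * c₃)
  let θ₃ : ℝ := ρ₁ + Lbar
  let θ₄ : ℝ := l2Norm (A - 1)
  !![(1 - α) * ρ₁, α * c₂ * θ₁, 0;
     θ₂ * (α * θ₃ + θ₄), ρ₂ + α * θ₁ * θ₂, 2 * α * c₁ * θ₂;
     α * Lbar / c₁, α * √N * θ₁ / c₁, 1 - δ * α / (4 * κ ^ 2)]

/-- `(x k i, y k i)` are the sequences generated by the DOT algorithm with stepsize `α`,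
from the initial points `x 0 i`, which are arbitrary. -/
structure IsDOTSequence {H : Type*} [NormedAddCommGroup H] [InnerProductSpace ℝ H] {N : ℕ}
    (A B : Matrix (Fin N) (Fin N) ℝ) (ν : Fin N → ℝ) (F : Fin N → H → H) (α : ℝ)
    (x y : ℕ → Fin N → H) : Prop where
  init : ∀ i, y 0 i = F i (x 0 i)
  step_x : ∀ k i, x (k + 1) i =
    (∑ j, A i j • x k j) + α • ((1 / ((N : ℝ) * ν i)) • y k i - ∑ j, A i j • x k j)
  step_y : ∀ k i, y (k + 1) i =
    (∑ j, B i j • y k j) + F i (x (k + 1) i) - F i (x k i)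

end DOT

end

/-! Three errors are followed along the iteration: the disagreement of the `x i` with their
π-weighted mean `m`, the disagreement of the `y i` with `ν i • ∑ j, y j`, and the distance from `m`
to the fixed points of `globalOp F`. The sum of the `y i` always equals `∑ i, F i (x i)` (`sum_y`),
so `m` performs a perturbed relaxed step of the global operator, and the perturbation is controlled
by the first two errors.

The network contracts both disagreements. A variance identity with strong connectivity and
compactness gives `exists_wnorm_contraction` for `A`; conjugating by `diag ν` gives the same for
`B`. `wnorm_matAct_le` carries such bounds from real vectors to vectors of a Hilbert space.
Quasi-nonexpansiveness and linear regularity contract the third error (`infDist_relax_le`). With the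
last two errors rescaled by `√N + 1` and `√N`, the estimates `consensus_le`, `tracking_le` and
`dist_le` form a linear recursion with matrix `stepMatrix`.

Since no root of `det (1 - M)` lies in `(0, α]`, `stepDet_pos` makes the determinant positive at
`α`. For a nonnegative matrix of this shape, that yields a positive vector shrunk by a factor `r <
1`, hence geometric decay of all errors. The means are then Cauchy (`exists_limit`), and their limit
is fixed by the average operator, hence by every `F i` (`fixedPoints_globalOp`). -/

namespace DOT

/-- The weighted `ℓ²` norm `√(∑ i, w i * ‖X i‖²)` of a family of vectors. -/
noncomputable def wnorm {E : Type*} [NormedAddCommGroup E] {N : ℕ} (w : Fin N → ℝ)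
    (X : Fin N → E) : ℝ :=
  √(∑ i, w i * ‖X i‖ ^ 2)

/-- The action `P ⊗ I` of a real matrix on a family of vectors. -/
def matAct {E : Type*} [AddCommGroup E] [Module ℝ E] {N : ℕ} (P : Matrix (Fin N) (Fin N) ℝ)
    (X : Fin N → E) : Fin N → E :=
  fun i => ∑ j, P i j • X j

/-! ### Weighted `ℓ²` norms of families. -/

section Normed

variable {E : Type*} [NormedAddCommGroup E] {N : ℕ}

lemma wnorm_nonneg (w : Fin N → ℝ) (X : Fin N → E) : 0 ≤ wnorm w X := Real.sqrt_nonneg _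

lemma wnorm_sq {w : Fin N → ℝ} (hw : ∀ i, 0 ≤ w i) (X : Fin N → E) :
    wnorm w X ^ 2 = ∑ i, w i * ‖X i‖ ^ 2 :=
  Real.sq_sqrt (Finset.sum_nonneg fun i _ => mul_nonneg (hw i) (sq_nonneg _))

lemma wnorm_le_of_norm_le {w : Fin N → ℝ} (hw : ∀ i, 0 ≤ w i) {F : Type*} [NormedAddCommGroup F]
    {X : Fin N → E} {Y : Fin N → F}
    {c : ℝ} (hc : 0 ≤ c) (h : ∀ i, ‖X i‖ ≤ c * ‖Y i‖) : wnorm w X ≤ c * wnorm w Y := by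
  rw [wnorm, wnorm, ← Real.sqrt_sq hc, ← Real.sqrt_mul (sq_nonneg _), Finset.mul_sum]
  refine Real.sqrt_le_sqrt (Finset.sum_le_sum fun i _ => ?_)
  have := pow_le_pow_left₀ (norm_nonneg _) (h i) 2
  nlinarith [mul_le_mul_of_nonneg_left this (hw i)]

lemma norm_le_wnorm_one (X : Fin N → E) (i : Fin N) : ‖X i‖ ≤ wnorm (fun _ => 1) X := by
  refine Real.le_sqrt_of_sq_le ?_
  simp only [one_mul]
  exact Finset.single_le_sum (f := fun i => ‖X i‖ ^ 2) (fun i _ => sq_nonneg _) (Finset.mem_univ i)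

lemma wnorm_const {w : Fin N → ℝ} (v : E) : wnorm w (fun _ => v) = √(∑ i, w i) * ‖v‖ := by
  rw [wnorm, ← Finset.sum_mul, mul_comm, Real.sqrt_mul (sq_nonneg _), Real.sqrt_sq (norm_nonneg _),
    mul_comm]

lemma sum_norm_le (X : Fin N → E) : ∑ i, ‖X i‖ ≤ √N * wnorm (fun _ => 1) X := by
  rw [wnorm, ← Real.sqrt_mul (Nat.cast_nonneg _)]
  refine Real.le_sqrt_of_sq_le ?_
  simpa using sq_sum_le_card_mul_sum_sq (s := Finset.univ) (f := fun i => ‖X i‖)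

end Normed

/-! ### The variance identity, and transfer from real vectors to families. -/

section Inner

variable {E : Type*} [NormedAddCommGroup E] [InnerProductSpace ℝ E] {N : ℕ}

lemma wnorm_eq_norm_toLp {w : Fin N → ℝ} (hw : ∀ i, 0 ≤ w i) (X : Fin N → E) :
    wnorm w X = ‖WithLp.toLp 2 (fun i => √(w i) • X i)‖ := by
  rw [PiLp.norm_eq_of_L2, wnorm]
  congr 1
  refine Finset.sum_congr rfl fun i _ => ?_
  simp [norm_smul, mul_pow, Real.sq_sqrt (hw i)]

lemma wnorm_add_le {w : Fin N → ℝ} (hw : ∀ i, 0 ≤ w i) (X Y : Fin N → E) :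
    wnorm w (fun i => X i + Y i) ≤ wnorm w X + wnorm w Y := by
  simp only [wnorm_eq_norm_toLp hw]
  refine le_trans (le_of_eq ?_) (norm_add_le _ _)
  congr 1
  ext i
  simp

lemma wnorm_smul (w : Fin N → ℝ) (c : ℝ) (X : Fin N → E) :
    wnorm w (fun i => c • X i) = |c| * wnorm w X := by
  rw [wnorm, wnorm, ← Real.sqrt_sq (abs_nonneg c), ← Real.sqrt_mul (sq_nonneg _),
    Finset.mul_sum]
  congr 1
  refine Finset.sum_congr rfl fun i _ => ?_
  rw [norm_smul, Real.norm_eq_abs]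
  ring

/-- The variance identity, from expanding the square about the mean. It is behind the bounds for
projections, the contraction by `A` and the description of common fixed points. -/
lemma sum_mul_norm_sub_sq {w : Fin N → ℝ} (hw1 : ∑ i, w i = 1)
    (X : Fin N → E) :
    ∑ i, w i * ‖X i - ∑ j, w j • X j‖ ^ 2 = (∑ i, w i * ‖X i‖ ^ 2) - ‖∑ j, w j • X j‖ ^ 2 := by
  set m := ∑ j, w j • X j with hm
  have h1 : ∀ i, w i * ‖X i - m‖ ^ 2 =
      w i * ‖X i‖ ^ 2 - 2 * inner ℝ (w i • X i) m + w i * ‖m‖ ^ 2 := fun i => by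
    rw [norm_sub_sq_real, real_inner_smul_left]
    ring
  simp only [h1, Finset.sum_add_distrib, Finset.sum_sub_distrib, ← Finset.mul_sum, ← sum_inner,
    ← hm, ← Finset.sum_mul, hw1, real_inner_self_eq_norm_sq]
  ring

lemma wnorm_sub_mean_le {w : Fin N → ℝ} (hw1 : ∑ i, w i = 1) (X : Fin N → E) :
    wnorm w (fun i => X i - ∑ j, w j • X j) ≤ wnorm w X := by
  refine Real.sqrt_le_sqrt ?_
  rw [sum_mul_norm_sub_sq hw1]
  linarith [sq_nonneg ‖∑ j, w j • X j‖]

lemma norm_mean_le {w : Fin N → ℝ} (hw : ∀ i, 0 ≤ w i) (hw1 : ∑ i, w i = 1) (X : Fin N → E) :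
    ‖∑ j, w j • X j‖ ≤ wnorm w X := by
  refine Real.le_sqrt_of_sq_le ?_
  have h := sum_mul_norm_sub_sq hw1 X
  have : 0 ≤ ∑ i, w i * ‖X i - ∑ j, w j • X j‖ ^ 2 :=
    Finset.sum_nonneg fun i _ => mul_nonneg (hw i) (sq_nonneg _)
  linarith

lemma wnorm_inv_eq {ν : Fin N → ℝ} (hν : ∀ i, 0 < ν i) (Y : Fin N → E) :
    wnorm (fun i => (ν i)⁻¹) Y = wnorm ν (fun i => (ν i)⁻¹ • Y i) := by
  rw [wnorm, wnorm]
  congr 1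
  refine Finset.sum_congr rfl fun i _ => ?_
  have := (hν i).ne'
  rw [norm_smul, Real.norm_eq_abs, abs_of_pos (inv_pos.2 (hν i))]
  field_simp

/-- In the variables `(ν i)⁻¹ • Y i` this is subtraction of the ν-weighted mean, which cannot
increase the ν-weighted norm. -/
lemma wnorm_inv_sub_smul_sum_le {ν : Fin N → ℝ} (hν : ∀ i, 0 < ν i) (hν1 : ∑ i, ν i = 1)
    (Y : Fin N → E) :
    wnorm (fun i => (ν i)⁻¹) (fun i => Y i - ν i • ∑ j, Y j) ≤ wnorm (fun i => (ν i)⁻¹) Y := by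
  rw [wnorm_inv_eq hν, wnorm_inv_eq hν]
  refine le_trans (le_of_eq ?_) (wnorm_sub_mean_le hν1 _)
  congr 1
  ext i
  simp only [smul_sub, smul_smul, mul_inv_cancel₀ (hν _).ne', inv_mul_cancel₀ (hν _).ne', one_smul]

/-- A bound between weighted norms for a real matrix acting on real vectors carries over to
families of vectors of an inner product space. -/
lemma wnorm_matAct_le {w v : Fin N → ℝ} (hw : ∀ i, 0 ≤ w i) (hv : ∀ i, 0 ≤ v i)
    {P : Matrix (Fin N) (Fin N) ℝ} {c : ℝ} (hc : 0 ≤ c)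
    (h : ∀ x : Fin N → ℝ, wnorm w (P *ᵥ x) ≤ c * wnorm v x) (X : Fin N → E) :
    wnorm w (matAct P X) ≤ c * wnorm v X := by
  -- Only the finite-dimensional span of the entries matters. In an orthonormal basis of it the
  -- scalar bound applies to each coordinate, and Parseval adds up the squares.
  let S := Submodule.span ℝ (Set.range X)
  let Y : Fin N → S := fun i => ⟨X i, Submodule.subset_span ⟨i, rfl⟩⟩
  have : FiniteDimensional ℝ S := FiniteDimensional.span_of_finite ℝ (Set.finite_range X)
  let b := stdOrthonormalBasis ℝ S
  have hY : ∀ z : S, ‖(z : E)‖ ^ 2 = ∑ k, ‖inner ℝ (b k) z‖ ^ 2 := fun z => by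
    rw [b.sum_sq_norm_inner_right z, Submodule.coe_norm]
  have hP : ∀ i, matAct P X i = ((matAct P Y i : S) : E) := fun i => by simp [matAct, Y]
  have key : ∀ k, ∑ i, w i * ‖inner ℝ (b k) (matAct P Y i)‖ ^ 2 ≤
      c ^ 2 * ∑ i, v i * ‖inner ℝ (b k) (Y i)‖ ^ 2 := fun k => by
    have h1 := pow_le_pow_left₀ (wnorm_nonneg _ _) (h fun i => inner ℝ (b k) (Y i)) 2
    rw [mul_pow, wnorm_sq hw, wnorm_sq hv] at h1
    refine le_trans (le_of_eq ?_) h1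
    refine Finset.sum_congr rfl fun i _ => ?_
    simp only [matAct, inner_sum, inner_smul_right, Matrix.mulVec, dotProduct]
  have hsum : wnorm w (matAct P X) ^ 2 ≤ (c * wnorm v X) ^ 2 := by
    rw [mul_pow, wnorm_sq hw, wnorm_sq hv]
    have h2 := Finset.sum_le_sum fun k (_ : k ∈ Finset.univ) => key k
    have h3 : ∀ i, ‖X i‖ ^ 2 = ∑ k, ‖inner ℝ (b k) (Y i)‖ ^ 2 := fun i => hY (Y i)
    simp only [hP, hY, h3]
    simp only [Finset.mul_sum] at h2 ⊢
    rw [Finset.sum_comm, Finset.sum_comm (s := (Finset.univ : Finset (Fin N)))]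
    exact h2
  exact le_of_sq_le_sq hsum (mul_nonneg hc (wnorm_nonneg _ _))

lemma wnorm_le_of_scalar {w v : Fin N → ℝ} (hw : ∀ i, 0 ≤ w i) (hv : ∀ i, 0 ≤ v i)
    {c : ℝ} (hc : 0 ≤ c) (h : ∀ x : Fin N → ℝ, wnorm w x ≤ c * wnorm v x) (X : Fin N → E) :
    wnorm w X ≤ c * wnorm v X := by
  have := wnorm_matAct_le hw hv (P := 1) hc (by simpa using h) X
  have h1 : matAct 1 X = X := by
    ext i
    simp [matAct, Matrix.one_apply, ite_smul]
  rwa [h1] at this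

end Inner

/-! ### The norms of the statement as weighted norms, and induced matrix norms. -/

section MatrixNorms

variable {E : Type*} [NormedAddCommGroup E] [InnerProductSpace ℝ E] {N : ℕ}

lemma piNorm_eq_wnorm (π x : Fin N → ℝ) : piNorm π x = wnorm π x := by
  simp [piNorm, wnorm]

lemma nuNorm_eq_wnorm (ν x : Fin N → ℝ) : nuNorm ν x = wnorm (fun i => (ν i)⁻¹) x := by
  simp [nuNorm, wnorm, div_eq_inv_mul]

lemma norm_eq_wnorm (x : EuclideanSpace ℝ (Fin N)) : ‖x‖ = wnorm (fun _ => 1) (x : Fin N → ℝ) := by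
  simp [wnorm, EuclideanSpace.norm_eq]

lemma inducedNorm_nonneg (n : (Fin N → ℝ) → ℝ) (P : Matrix (Fin N) (Fin N) ℝ) :
    0 ≤ inducedNorm n P :=
  Real.sInf_nonneg fun _ hc => hc.1

lemma inducedNorm_le {n : (Fin N → ℝ) → ℝ} {P : Matrix (Fin N) (Fin N) ℝ} {c : ℝ} (hc : 0 ≤ c)
    (h : ∀ x, n (P *ᵥ x) ≤ c * n x) : inducedNorm n P ≤ c :=
  csInf_le ⟨0, fun _ h => h.1⟩ ⟨hc, h⟩

/-- Some admissible `c` is needed: it makes the set under the infimum nonempty, and it settles the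
vectors with `n x = 0`. -/
lemma le_inducedNorm_mul {n : (Fin N → ℝ) → ℝ} (hn : ∀ x, 0 ≤ n x)
    {P : Matrix (Fin N) (Fin N) ℝ} {c : ℝ} (hc : 0 ≤ c)
    (h : ∀ x, n (P *ᵥ x) ≤ c * n x) (x : Fin N → ℝ) : n (P *ᵥ x) ≤ inducedNorm n P * n x := by
  rcases (hn x).eq_or_lt with h0 | h0
  · have := h x
    rwa [← h0, mul_zero] at this ⊢
  · rw [← div_le_iff₀ h0]
    exact le_csInf ⟨c, hc, h⟩ fun c' hc' => (div_le_iff₀ h0).2 (hc'.2 x)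

lemma wnorm_matAct_le_l2Norm (P : Matrix (Fin N) (Fin N) ℝ) (X : Fin N → E) :
    wnorm (fun _ => 1) (matAct P X) ≤ l2Norm P * wnorm (fun _ => 1) X := by
  refine wnorm_matAct_le (fun _ => zero_le_one) (fun _ => zero_le_one) (norm_nonneg _)
    (fun x => ?_) X
  have := (Matrix.toEuclideanCLM (𝕜 := ℝ) P).le_opNorm (WithLp.toLp 2 x)
  rw [norm_eq_wnorm, norm_eq_wnorm] at this
  simpa [l2Norm] using this

lemma inv_le_l2Norm_inv_diagonal {ν : Fin N → ℝ} (hν : ∀ i, 0 < ν i) (i : Fin N) :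
    (ν i)⁻¹ ≤ l2Norm ((Matrix.diagonal ν)⁻¹) := by
  have hinv : (Matrix.diagonal ν)⁻¹ = Matrix.diagonal fun i => (ν i)⁻¹ := by
    refine Matrix.inv_eq_right_inv ?_
    rw [Matrix.diagonal_mul_diagonal, ← Matrix.diagonal_one]
    congr 1
    ext j
    exact mul_inv_cancel₀ (hν j).ne'
  have h := (Matrix.toEuclideanCLM (𝕜 := ℝ) (Matrix.diagonal fun i => (ν i)⁻¹)).le_opNorm
    (EuclideanSpace.single i 1)
  rw [PiLp.norm_single, norm_one, mul_one] at h
  have h2 := norm_le_wnorm_one (N := N) (fun j => (Matrix.toEuclideanCLM (𝕜 := ℝ)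
    (Matrix.diagonal fun i => (ν i)⁻¹) (EuclideanSpace.single i 1)) j) i
  rw [← norm_eq_wnorm] at h2
  rw [l2Norm, hinv]
  refine le_trans (le_of_eq ?_) (h2.trans h)
  have : (Matrix.toEuclideanCLM (𝕜 := ℝ) (Matrix.diagonal fun i => (ν i)⁻¹)
      (EuclideanSpace.single i 1)) i = (ν i)⁻¹ := by
    simp [Matrix.ofLp_toEuclideanCLM, Matrix.mulVec_diagonal]
  rw [this, Real.norm_eq_abs, abs_of_pos (inv_pos.2 (hν i))]

end MatrixNorms
-- Strict contraction by stochastic matrices.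
section Contraction

variable {N : ℕ}

lemma sub_Ainf_mulVec {A : Matrix (Fin N) (Fin N) ℝ} {π : Fin N → ℝ}
    (hrow : ∀ i, ∑ j, A i j = 1) (x : Fin N → ℝ) :
    (A - Ainf π) *ᵥ x = A *ᵥ (fun i => x i - ∑ j, π j • x j) := by
  ext i
  simp only [Matrix.mulVec, dotProduct, Matrix.sub_apply, Ainf, Matrix.of_apply, sub_mul, mul_sub,
    Finset.sum_sub_distrib, ← Finset.sum_mul, hrow, one_mul, smul_eq_mul]

/-- The variance identity in each row of `A`, averaged with the invariant weights `π`: the loss of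
squared norm under `A` is a sum of squares over the edges. -/
lemma sum_mul_sum_sq_eq {A : Matrix (Fin N) (Fin N) ℝ} {π : Fin N → ℝ} (hrow : ∀ i, ∑ j, A i j = 1)
    (hπA : π ᵥ* A = π) (x : Fin N → ℝ) :
    ∑ i, π i * ∑ j, A i j * ‖x j - (A *ᵥ x) i‖ ^ 2 =
      (∑ i, π i * ‖x i‖ ^ 2) - ∑ i, π i * ‖(A *ᵥ x) i‖ ^ 2 := by
  have h1 : ∀ i, ∑ j, A i j * ‖x j - (A *ᵥ x) i‖ ^ 2 =
      (∑ j, A i j * ‖x j‖ ^ 2) - ‖(A *ᵥ x) i‖ ^ 2 := fun i => by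
    simpa only [smul_eq_mul, Matrix.mulVec, dotProduct] using sum_mul_norm_sub_sq (hrow i) x
  simp only [h1, mul_sub, Finset.sum_sub_distrib]
  congr 1
  calc ∑ i, π i * ∑ j, A i j * ‖x j‖ ^ 2 = ∑ j, (π ᵥ* A) j * ‖x j‖ ^ 2 := by
        simp only [Finset.mul_sum, Matrix.vecMul, dotProduct, Finset.sum_mul]
        rw [Finset.sum_comm]
        simp only [mul_assoc]
    _ = _ := by rw [hπA]

/-- After removal of the mean, equality would make every edge term of the loss vanish, so the
deviation would be constant along paths, hence constant, and being of mean zero it would be `0`. -/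
lemma wnorm_mulVec_lt {A : Matrix (Fin N) (Fin N) ℝ} {π : Fin N → ℝ} (hA : ∀ i j, 0 ≤ A i j)
    (hrow : ∀ i, ∑ j, A i j = 1) (hdiag : ∀ i, 0 < A i i)
    (hconn : ∀ i j, Relation.ReflTransGen (fun a b => 0 < A b a) i j)
    (hπ : ∀ i, 0 < π i) (hπ1 : ∑ i, π i = 1) (hπA : π ᵥ* A = π) {x : Fin N → ℝ} (hx : x ≠ 0) :
    wnorm π ((A - Ainf π) *ᵥ x) < wnorm π x := by
  rw [sub_Ainf_mulVec hrow]
  set e : Fin N → ℝ := fun i => x i - ∑ j, π j • x j with he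
  have hπ0 := fun i => (hπ i).le
  have hex : wnorm π e ≤ wnorm π x := wnorm_sub_mean_le hπ1 x
  have hterm : ∀ i, 0 ≤ π i * ∑ j, A i j * ‖e j - (A *ᵥ e) i‖ ^ 2 := fun i =>
    mul_nonneg (hπ0 i) (Finset.sum_nonneg fun j _ => mul_nonneg (hA i j) (sq_nonneg _))
  have hid := sum_mul_sum_sq_eq hrow hπA e
  rw [← wnorm_sq hπ0, ← wnorm_sq hπ0] at hid
  by_cases hcon : ∀ i j, e i = e j
  · have hmean : ∑ i, π i * e i = 0 := by
      simp only [he, mul_sub, Finset.sum_sub_distrib, ← Finset.sum_mul, hπ1, one_mul, smul_eq_mul,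
        sub_self]
    have he0 : e = 0 := by
      ext j
      rw [Finset.sum_congr rfl fun i _ => by rw [hcon i j], ← Finset.sum_mul, hπ1, one_mul] at hmean
      exact hmean
    obtain ⟨i, hi⟩ := Function.ne_iff.1 hx
    have hpos : 0 < wnorm π x := by
      refine Real.sqrt_pos.2 (Finset.sum_pos' (fun i _ => mul_nonneg (hπ0 i) (sq_nonneg _))
        ⟨i, Finset.mem_univ i, mul_pos (hπ i) (pow_pos (norm_pos_iff.2 hi) 2)⟩)
    have : wnorm π (A *ᵥ e) = 0 := by rw [he0, Matrix.mulVec_zero]; simp [wnorm]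
    rwa [this]
  · refine lt_of_lt_of_le ?_ hex
    refine lt_of_pow_lt_pow_left₀ 2 (wnorm_nonneg _ _) ?_
    have h0 : 0 ≤ ∑ i, π i * ∑ j, A i j * ‖e j - (A *ᵥ e) i‖ ^ 2 :=
      Finset.sum_nonneg fun i _ => hterm i
    rcases h0.eq_or_lt with h0 | h0
    · exfalso
      have hz : ∀ i j, 0 < A i j → e j = (A *ᵥ e) i := fun i j hij => by
        have h1 := (Finset.sum_eq_zero_iff_of_nonneg fun i _ => hterm i).1 h0.symm i
          (Finset.mem_univ i)
        have h2 := (mul_eq_zero.1 h1).resolve_left (hπ i).ne'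
        have h3 := (Finset.sum_eq_zero_iff_of_nonneg fun j _ =>
          mul_nonneg (hA i j) (sq_nonneg _)).1 h2 j (Finset.mem_univ j)
        have h4 := (mul_eq_zero.1 h3).resolve_left hij.ne'
        exact sub_eq_zero.1 (norm_eq_zero.1 (pow_eq_zero_iff two_ne_zero |>.1 h4))
      refine hcon fun i j => ?_
      induction hconn i j with
      | refl => rfl
      -- The positive diagonal entry at the end of the edge identifies the row average there with
      -- the value of `e` at that node.
      | tail _ hbc ih => rw [ih, hz _ _ hbc, ← hz _ _ (hdiag _)]
    · linarith

/-- The strict inequality becomes uniform because the quotient of the two sides attains its maximum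
on the compact unit sphere and is homogeneous of degree zero. -/
lemma exists_wnorm_contraction (hN : 0 < N) {A : Matrix (Fin N) (Fin N) ℝ} {π : Fin N → ℝ}
    (hA : ∀ i j, 0 ≤ A i j)
    (hrow : ∀ i, ∑ j, A i j = 1) (hdiag : ∀ i, 0 < A i i)
    (hconn : ∀ i j, Relation.ReflTransGen (fun a b => 0 < A b a) i j)
    (hπ : ∀ i, 0 < π i) (hπ1 : ∑ i, π i = 1) (hπA : π ᵥ* A = π) :
    ∃ c, 0 ≤ c ∧ c < 1 ∧ ∀ x : Fin N → ℝ, wnorm π ((A - Ainf π) *ᵥ x) ≤ c * wnorm π x := by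
  have : Nonempty (Fin N) := ⟨⟨0, hN⟩⟩
  have hlt := fun {x : Fin N → ℝ} (hx : x ≠ 0) => wnorm_mulVec_lt hA hrow hdiag hconn hπ hπ1 hπA hx
  have hpos : ∀ x : Fin N → ℝ, x ≠ 0 → 0 < wnorm π x := fun x hx =>
    lt_of_le_of_lt (wnorm_nonneg _ _) (hlt hx)
  have hne : ∀ x ∈ Metric.sphere (0 : Fin N → ℝ) 1, x ≠ 0 := fun x hx h => by
    simp [h] at hx
  have hcw : Continuous fun x : Fin N → ℝ => wnorm π x := by unfold wnorm; fun_prop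
  have hcont : ContinuousOn (fun x : Fin N → ℝ => wnorm π ((A - Ainf π) *ᵥ x) / wnorm π x)
      (Metric.sphere 0 1) :=
    ((hcw.comp (Continuous.matrix_mulVec continuous_const continuous_id)).continuousOn).div
      hcw.continuousOn fun x hx => (hpos x (hne x hx)).ne'
  obtain ⟨z, hz, hmax⟩ := (isCompact_sphere (0 : Fin N → ℝ) 1).exists_isMaxOn
    (NormedSpace.sphere_nonempty.2 zero_le_one) hcont
  refine ⟨wnorm π ((A - Ainf π) *ᵥ z) / wnorm π z, div_nonneg (wnorm_nonneg _ _) (wnorm_nonneg _ _),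
    (div_lt_one (hpos z (hne z hz))).2 (hlt (hne z hz)), fun x => ?_⟩
  by_cases hx : x = 0
  · subst hx
    simp [wnorm]
  have hn : 0 < ‖x‖ := norm_pos_iff.2 hx
  have hmem : ‖x‖⁻¹ • x ∈ Metric.sphere (0 : Fin N → ℝ) 1 := by
    simp [norm_smul, inv_mul_cancel₀ hn.ne']
  have h1 := hmax hmem
  simp only [Set.mem_ofPred_eq, Matrix.mulVec_smul] at h1
  have h2 : ∀ y : Fin N → ℝ, wnorm π (‖x‖⁻¹ • y) = ‖x‖⁻¹ * wnorm π y := fun y => by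
    have := wnorm_smul π ‖x‖⁻¹ y
    rw [abs_of_pos (inv_pos.2 hn)] at this
    exact this
  rw [h2, h2, mul_div_mul_left _ _ (inv_pos.2 hn).ne'] at h1
  exact (div_le_iff₀ (hpos x hx)).1 h1

lemma exists_wnorm_inv_contraction (hN : 0 < N) {B : Matrix (Fin N) (Fin N) ℝ} {ν : Fin N → ℝ}
    (hB : ∀ i j, 0 ≤ B i j)
    (hcol : ∀ j, ∑ i, B i j = 1) (hdiag : ∀ i, 0 < B i i)
    (hconn : ∀ i j, Relation.ReflTransGen (fun a b => 0 < B b a) i j)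
    (hν : ∀ i, 0 < ν i) (hν1 : ∑ i, ν i = 1) (hBν : B *ᵥ ν = ν) :
    ∃ c, 0 ≤ c ∧ c < 1 ∧ ∀ x : Fin N → ℝ,
      wnorm (fun i => (ν i)⁻¹) ((B - Binf ν) *ᵥ x) ≤ c * wnorm (fun i => (ν i)⁻¹) x := by
  -- The conjugate of `B` by `diag ν` is row-stochastic because `B *ᵥ ν = ν`, and has left
  -- eigenvector `ν` because the columns of `B` sum to one.
  let A : Matrix (Fin N) (Fin N) ℝ := Matrix.of fun i j => (ν i)⁻¹ * B i j * ν j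
  have hApos : ∀ i j, 0 < B i j → 0 < A i j := fun i j h =>
    mul_pos (mul_pos (inv_pos.2 (hν i)) h) (hν j)
  obtain ⟨c, hc0, hc1, hc⟩ := exists_wnorm_contraction (A := A) hN
    (fun i j => mul_nonneg (mul_nonneg (inv_pos.2 (hν i)).le (hB i j)) (hν j).le)
    (fun i => by
      have := congrFun hBν i
      simp only [Matrix.mulVec, dotProduct] at this
      simp only [A, Matrix.of_apply, mul_assoc, ← Finset.mul_sum, this]
      exact inv_mul_cancel₀ (hν i).ne')
    (fun i => hApos i i (hdiag i))
    (fun i j => (hconn i j).lift id fun a b h => hApos b a h) hν hν1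
    (by
      ext j
      have : ∀ i, ν i * A i j = B i j * ν j := fun i => by
        simp only [A, Matrix.of_apply]
        rw [← mul_assoc, ← mul_assoc, mul_inv_cancel₀ (hν i).ne', one_mul]
      simp only [Matrix.vecMul, dotProduct, this, ← Finset.sum_mul, hcol, one_mul])
  refine ⟨c, hc0, hc1, fun x => ?_⟩
  rw [wnorm_inv_eq hν, wnorm_inv_eq hν]
  refine le_trans (le_of_eq ?_) (hc _)
  congr 1
  ext i
  simp only [Matrix.mulVec, dotProduct, Matrix.sub_apply, A, Ainf, Binf, Matrix.of_apply,
    smul_eq_mul, Finset.mul_sum]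
  refine Finset.sum_congr rfl fun j _ => ?_
  have h1 := (hν i).ne'
  have h2 := (hν j).ne'
  field_simp

end Contraction

/-! ### Contraction constants of the network. -/

section Network

variable {E : Type*} [NormedAddCommGroup E] [InnerProductSpace ℝ E] {N : ℕ}
  {G : Digraph (Fin N)} {A B : Matrix (Fin N) (Fin N) ℝ} {π ν : Fin N → ℝ}

lemma Compatible.reflTransGen {P : Matrix (Fin N) (Fin N) ℝ} (h : Compatible G P)
    (hG : StronglyConnected G) (i j : Fin N) :
    Relation.ReflTransGen (fun a b => 0 < P b a) i j :=
  (hG i j).lift id fun a b hab => by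
    by_cases e : b = a
    · rw [e]; exact h.diag_pos a
    · exact (h.pos_iff b a e).2 hab

lemma IsNetwork.exists_contraction_row (h : IsNetwork G A B π ν) (hN : 0 < N) :
    ∃ c, 0 ≤ c ∧ c < 1 ∧ ∀ x, piNorm π ((A - Ainf π) *ᵥ x) ≤ c * piNorm π x := by
  have hA := Matrix.mem_rowStochastic_iff_sum.1 h.row_stoch
  simpa only [piNorm_eq_wnorm] using exists_wnorm_contraction hN hA.1 hA.2 h.compatA.diag_pos
    (h.compatA.reflTransGen h.strong) h.pi_pos h.pi_sum h.pi_eig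

lemma IsNetwork.exists_contraction_col (h : IsNetwork G A B π ν) (hN : 0 < N) :
    ∃ c, 0 ≤ c ∧ c < 1 ∧ ∀ x, nuNorm ν ((B - Binf ν) *ᵥ x) ≤ c * nuNorm ν x := by
  have hB := Matrix.mem_colStochastic_iff_sum.1 h.col_stoch
  simpa only [nuNorm_eq_wnorm] using exists_wnorm_inv_contraction hN hB.1 hB.2 h.compatB.diag_pos
    (h.compatB.reflTransGen h.strong) h.nu_pos h.nu_sum h.nu_eig

lemma IsNetwork.inducedNorm_row_lt_one (h : IsNetwork G A B π ν) (hN : 0 < N) :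
    inducedNorm (piNorm π) (A - Ainf π) < 1 := by
  obtain ⟨c, h0, h1, hc⟩ := h.exists_contraction_row hN
  exact (inducedNorm_le h0 hc).trans_lt h1

lemma IsNetwork.inducedNorm_col_lt_one (h : IsNetwork G A B π ν) (hN : 0 < N) :
    inducedNorm (nuNorm ν) (B - Binf ν) < 1 := by
  obtain ⟨c, h0, h1, hc⟩ := h.exists_contraction_col hN
  exact (inducedNorm_le h0 hc).trans_lt h1

lemma IsNetwork.wnorm_matAct_row_le (h : IsNetwork G A B π ν) (hN : 0 < N) (X : Fin N → E) :
    wnorm π (matAct (A - Ainf π) X) ≤ inducedNorm (piNorm π) (A - Ainf π) * wnorm π X := by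
  obtain ⟨c, h0, h1, hc⟩ := h.exists_contraction_row hN
  refine wnorm_matAct_le (fun i => (h.pi_pos i).le) (fun i => (h.pi_pos i).le)
    (inducedNorm_nonneg _ _) (fun x => ?_) X
  simpa only [piNorm_eq_wnorm] using le_inducedNorm_mul (n := piNorm π) (fun _ => Real.sqrt_nonneg _) h0 hc x

lemma IsNetwork.wnorm_matAct_col_le (h : IsNetwork G A B π ν) (hN : 0 < N) (X : Fin N → E) :
    wnorm (fun i => (ν i)⁻¹) (matAct (B - Binf ν) X) ≤
      inducedNorm (nuNorm ν) (B - Binf ν) * wnorm (fun i => (ν i)⁻¹) X := by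
  obtain ⟨c, h0, h1, hc⟩ := h.exists_contraction_col hN
  have hν := fun i => (inv_pos.2 (h.nu_pos i)).le
  refine wnorm_matAct_le hν hν (inducedNorm_nonneg _ _) (fun x => ?_) X
  simpa only [nuNorm_eq_wnorm] using le_inducedNorm_mul (n := nuNorm ν) (fun _ => Real.sqrt_nonneg _) h0 hc x

end Network
-- Nonnegative `3 × 3` recursions and positivity of the determinant.
/-- A nonnegative `3 × 3` matrix `a` with `a₁₃ = 0`, `a₁₁, a₃₃ < 1` and `det (1 - a) > 0` shrinks
some positive vector. -/
lemma exists_pos_contracted_vector {a₁₁ a₁₂ a₂₁ a₂₂ a₂₃ a₃₁ a₃₂ a₃₃ : ℝ} (h₁₂ : 0 ≤ a₁₂)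
    (h₂₁ : 0 ≤ a₂₁) (h₂₃ : 0 ≤ a₂₃) (h₃₁ : 0 ≤ a₃₁) (h₃₂ : 0 ≤ a₃₂)
    (h₁₁ : a₁₁ < 1) (h₃₃ : a₃₃ < 1)
    (hdet : 0 < (1 - a₁₁) * ((1 - a₂₂) * (1 - a₃₃) - a₂₃ * a₃₂)
      - a₁₂ * (a₂₁ * (1 - a₃₃) + a₂₃ * a₃₁)) :
    ∃ w₁ w₂ w₃ r : ℝ, 0 < w₁ ∧ 0 < w₂ ∧ 0 < w₃ ∧ 0 < r ∧ r < 1 ∧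
      a₁₁ * w₁ + a₁₂ * w₂ ≤ r * w₁ ∧ a₂₁ * w₁ + a₂₂ * w₂ + a₂₃ * w₃ ≤ r * w₂ ∧
      a₃₁ * w₁ + a₃₂ * w₂ + a₃₃ * w₃ ≤ r * w₃ := by
  obtain ⟨a, rfl⟩ : ∃ a, a₁₁ = 1 - a := ⟨1 - a₁₁, by ring⟩
  obtain ⟨b, rfl⟩ : ∃ b, a₂₂ = 1 - b := ⟨1 - a₂₂, by ring⟩
  obtain ⟨g, rfl⟩ : ∃ g, a₃₃ = 1 - g := ⟨1 - a₃₃, by ring⟩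
  have ha : 0 < a := by linarith
  have hg : 0 < g := by linarith
  simp only [sub_sub_cancel] at hdet
  set Δ := a * (b * g - a₂₃ * a₃₂) - a₁₂ * (a₂₁ * g + a₂₃ * a₃₁) with hΔ
  have e1 : 0 < b * g - a₂₃ * a₃₂ := by
    have : 0 ≤ a₁₂ * (a₂₁ * g + a₂₃ * a₃₁) := by positivity
    exact pos_of_mul_pos_right (by linarith : 0 < a * (b * g - a₂₃ * a₃₂)) ha.le
  have hb : 0 < b := by
    have : 0 ≤ a₂₃ * a₃₂ := by positivity
    exact pos_of_mul_pos_left (by linarith : 0 < b * g) hg.le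
  have e2 : 0 < a * b - a₁₂ * a₂₁ := by
    have h0 : 0 ≤ a * (a₂₃ * a₃₂) + a₁₂ * (a₂₃ * a₃₁) := by positivity
    have h1 : 0 < (a * b - a₁₂ * a₂₁) * g := by
      have : (a * b - a₁₂ * a₂₁) * g = Δ + (a * (a₂₃ * a₃₂) + a₁₂ * (a₂₃ * a₃₁)) := by
        rw [hΔ]; ring
      linarith
    exact pos_of_mul_pos_left h1 hg.le
  -- The vector `w` is the adjugate of `1 - a` applied to `(1, 1, 1)`, so `(1 - a) w = Δ (1, 1, 1)`.
  -- Its entries are positive by the minors above.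
  obtain ⟨w₁, hw₁⟩ : ∃ w, w = b * g - a₂₃ * a₃₂ + a₁₂ * g + a₁₂ * a₂₃ := ⟨_, rfl⟩
  obtain ⟨w₂, hw₂⟩ : ∃ w, w = a₂₁ * g + a₂₃ * a₃₁ + a * g + a * a₂₃ := ⟨_, rfl⟩
  obtain ⟨w₃, hw₃⟩ : ∃ w, w = a₂₁ * a₃₂ + b * a₃₁ + a * a₃₂ + a₁₂ * a₃₁ + (a * b - a₁₂ * a₂₁) :=
    ⟨_, rfl⟩
  have p1 : 0 < w₁ := by rw [hw₁]; positivity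
  have p2 : 0 < w₂ := by rw [hw₂]; positivity
  have p3 : 0 < w₃ := by rw [hw₃]; positivity
  have r1 : (1 - a) * w₁ + a₁₂ * w₂ = w₁ - Δ := by rw [hw₁, hw₂, hΔ]; ring
  have r2 : a₂₁ * w₁ + (1 - b) * w₂ + a₂₃ * w₃ = w₂ - Δ := by rw [hw₁, hw₂, hw₃, hΔ]; ring
  have r3 : a₃₁ * w₁ + a₃₂ * w₂ + (1 - g) * w₃ = w₃ - Δ := by rw [hw₁, hw₂, hw₃, hΔ]; ring
  have hS : 0 < w₁ + w₂ + w₃ + Δ := by positivity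
  -- One rate for all rows: this `t` satisfies `t * wᵢ ≤ Δ`, and the summand `Δ` in the denominator
  -- keeps `t < 1`.
  set t := Δ / (w₁ + w₂ + w₃ + Δ) with ht
  have ht0 : 0 < t := by positivity
  have hle : ∀ w, w ≤ w₁ + w₂ + w₃ + Δ → t * w ≤ Δ := fun w hw => by
    rw [ht, div_mul_eq_mul_div, div_le_iff₀ hS]
    exact mul_le_mul_of_nonneg_left hw hdet.le
  refine ⟨w₁, w₂, w₃, 1 - t, p1, p2, p3, ?_, by linarith, ?_, ?_, ?_⟩
  · rw [sub_pos, ht, div_lt_one hS]; linarith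
  · rw [r1]; linarith [hle w₁ (by linarith)]
  · rw [r2]; linarith [hle w₂ (by linarith)]
  · rw [r3]; linarith [hle w₃ (by linarith)]

/-- Induction in the sup norm weighted by `w`: nonnegative coefficients preserve the bound by `K * r
^ k * wᵢ`, and `K` is chosen to dominate the initial errors. -/
lemma exists_geometric_bound {a₁₁ a₁₂ a₂₁ a₂₂ a₂₃ a₃₁ a₃₂ a₃₃ w₁ w₂ w₃ r : ℝ} (h₁₁ : 0 ≤ a₁₁)
    (h₁₂ : 0 ≤ a₁₂) (h₂₁ : 0 ≤ a₂₁) (h₂₂ : 0 ≤ a₂₂) (h₂₃ : 0 ≤ a₂₃) (h₃₁ : 0 ≤ a₃₁)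
    (h₃₂ : 0 ≤ a₃₂) (h₃₃ : 0 ≤ a₃₃) (hw₁ : 0 < w₁) (hw₂ : 0 < w₂) (hw₃ : 0 < w₃) (hr : 0 < r)
    (r₁ : a₁₁ * w₁ + a₁₂ * w₂ ≤ r * w₁) (r₂ : a₂₁ * w₁ + a₂₂ * w₂ + a₂₃ * w₃ ≤ r * w₂)
    (r₃ : a₃₁ * w₁ + a₃₂ * w₂ + a₃₃ * w₃ ≤ r * w₃)
    {s t d : ℕ → ℝ} (hs₀ : 0 ≤ s 0) (ht₀ : 0 ≤ t 0) (hd₀ : 0 ≤ d 0)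
    (hs : ∀ k, s (k + 1) ≤ a₁₁ * s k + a₁₂ * t k)
    (ht : ∀ k, t (k + 1) ≤ a₂₁ * s k + a₂₂ * t k + a₂₃ * d k)
    (hd : ∀ k, d (k + 1) ≤ a₃₁ * s k + a₃₂ * t k + a₃₃ * d k) :
    ∃ C : ℝ, ∀ k, s k ≤ C * r ^ k ∧ t k ≤ C * r ^ k ∧ d k ≤ C * r ^ k := by
  obtain ⟨K, hK⟩ : ∃ K, K = s 0 / w₁ + t 0 / w₂ + d 0 / w₃ := ⟨_, rfl⟩
  have hs' : 0 ≤ s 0 / w₁ := by positivity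
  have ht' : 0 ≤ t 0 / w₂ := by positivity
  have hd' : 0 ≤ d 0 / w₃ := by positivity
  have hK0 : 0 ≤ K := by linarith
  have key : ∀ k, s k ≤ K * r ^ k * w₁ ∧ t k ≤ K * r ^ k * w₂ ∧ d k ≤ K * r ^ k * w₃ := by
    intro k
    induction k with
    | zero =>
      simp only [pow_zero, mul_one]
      refine ⟨?_, ?_, ?_⟩
      · rw [← div_le_iff₀ hw₁]; linarith
      · rw [← div_le_iff₀ hw₂]; linarith
      · rw [← div_le_iff₀ hw₃]; linarith
    | succ k ih =>
      obtain ⟨i1, i2, i3⟩ := ih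
      have hq : 0 ≤ K * r ^ k := by positivity
      rw [pow_succ]
      refine ⟨?_, ?_, ?_⟩
      · calc s (k + 1) ≤ a₁₁ * s k + a₁₂ * t k := hs k
          _ ≤ a₁₁ * (K * r ^ k * w₁) + a₁₂ * (K * r ^ k * w₂) := by gcongr
          _ = K * r ^ k * (a₁₁ * w₁ + a₁₂ * w₂) := by ring
          _ ≤ K * r ^ k * (r * w₁) := by gcongr
          _ = K * (r ^ k * r) * w₁ := by ring
      · calc t (k + 1) ≤ a₂₁ * s k + a₂₂ * t k + a₂₃ * d k := ht k
          _ ≤ a₂₁ * (K * r ^ k * w₁) + a₂₂ * (K * r ^ k * w₂) + a₂₃ * (K * r ^ k * w₃) := by gcongr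
          _ = K * r ^ k * (a₂₁ * w₁ + a₂₂ * w₂ + a₂₃ * w₃) := by ring
          _ ≤ K * r ^ k * (r * w₂) := by gcongr
          _ = K * (r ^ k * r) * w₂ := by ring
      · calc d (k + 1) ≤ a₃₁ * s k + a₃₂ * t k + a₃₃ * d k := hd k
          _ ≤ a₃₁ * (K * r ^ k * w₁) + a₃₂ * (K * r ^ k * w₂) + a₃₃ * (K * r ^ k * w₃) := by gcongr
          _ = K * r ^ k * (a₃₁ * w₁ + a₃₂ * w₂ + a₃₃ * w₃) := by ring
          _ ≤ K * r ^ k * (r * w₃) := by gcongr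
          _ = K * (r ^ k * r) * w₃ := by ring
  refine ⟨K * (w₁ + w₂ + w₃), fun k => ?_⟩
  obtain ⟨i1, i2, i3⟩ := key k
  have hq : 0 ≤ K * r ^ k := by positivity
  have q1 := mul_nonneg hq hw₁.le
  have q2 := mul_nonneg hq hw₂.le
  have q3 := mul_nonneg hq hw₃.le
  refine ⟨?_, ?_, ?_⟩ <;> linarith

/-- If `b ↦ det (1 - M b)`, with `M` of the shape of the step matrix, has no zero in `(0, α]`, then
it is positive at `α`. -/
lemma stepDet_pos {ρ₁ ρ₂ p₁ q₀ q₁ p₂ p₂₃ p₃₁ p₃₂ g α : ℝ} (hρ₁ : ρ₁ < 1) (hρ₂ : ρ₂ < 1)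
    (hg : 0 < g) (hα : 0 < α)
    (hroot : ∀ b, 0 < b →
      (1 - (1 - b) * ρ₁) * ((1 - (ρ₂ + b * p₂)) * (b * g) - (b * p₂₃) * (b * p₃₂))
        - (b * p₁) * ((q₁ * b + q₀) * (b * g) + (b * p₂₃) * (b * p₃₁)) = 0 → α < b) :
    0 < (1 - (1 - α) * ρ₁) * ((1 - (ρ₂ + α * p₂)) * (α * g) - (α * p₂₃) * (α * p₃₂))
        - (α * p₁) * ((q₁ * α + q₀) * (α * g) + (α * p₂₃) * (α * p₃₁)) := by
  -- The determinant vanishes at `b = 0`, since the third row of `1 - M b` is a multiple of `b`. The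
  -- quotient `f` is positive at `0`, so `f α ≤ 0` would produce a root in `(0, α]`.
  let f : ℝ → ℝ := fun b =>
    (1 - (1 - b) * ρ₁) * ((1 - (ρ₂ + b * p₂)) * g - p₂₃ * (b * p₃₂))
        - (b * p₁) * ((q₁ * b + q₀) * g + p₂₃ * (b * p₃₁))
  have hf : ∀ b, (1 - (1 - b) * ρ₁) * ((1 - (ρ₂ + b * p₂)) * (b * g) - (b * p₂₃) * (b * p₃₂))
        - (b * p₁) * ((q₁ * b + q₀) * (b * g) + (b * p₂₃) * (b * p₃₁)) = b * f b := fun b => by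
    simp only [f]; ring
  rw [hf]
  refine mul_pos hα ?_
  by_contra! hneg
  have h0 : 0 < f 0 := by
    have : f 0 = (1 - ρ₁) * ((1 - ρ₂) * g) := by simp only [f]; ring
    rw [this]
    exact mul_pos (by linarith) (mul_pos (by linarith) hg)
  have hcont : ContinuousOn f (Set.Icc 0 α) := by fun_prop
  obtain ⟨b, hb, hb0⟩ := intermediate_value_Icc' hα.le hcont ⟨hneg, h0.le⟩
  have hbpos : 0 < b := lt_of_le_of_ne hb.1 fun h => by rw [← h] at hb0; linarith
  have := hroot b hbpos (by rw [hf, hb0, mul_zero])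
  linarith [hb.2]

/-! ### Quasi-nonexpansive operators. -/

section Operators

lemma QuasiNonexpansive.norm_sub_le_two_mul_infDist {E : Type*} [NormedAddCommGroup E]
    {T : E → E} (hT : QuasiNonexpansive T)
    (hne : (Function.fixedPoints T).Nonempty) (x : E) :
    ‖T x - x‖ ≤ 2 * Metric.infDist x (Function.fixedPoints T) := by
  rw [← div_le_iff₀' two_pos, Metric.le_infDist hne]
  intro p hp
  rw [div_le_iff₀' two_pos, dist_eq_norm]
  calc ‖T x - x‖ = ‖(T x - p) - (x - p)‖ := by congr 1; abel
    _ ≤ ‖T x - p‖ + ‖x - p‖ := norm_sub_le _ _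
    _ ≤ 2 * ‖x - p‖ := by linarith [hT x p hp]

variable {H : Type*} [NormedAddCommGroup H] [InnerProductSpace ℝ H] {T : H → H}

lemma norm_convex_comb_sq (a : ℝ) (u v : H) :
    ‖(1 - a) • u + a • v‖ ^ 2 =
      (1 - a) * ‖u‖ ^ 2 + a * ‖v‖ ^ 2 - a * (1 - a) * ‖v - u‖ ^ 2 := by
  rw [norm_add_sq_real, norm_sub_sq_real, norm_smul, norm_smul, real_inner_smul_left,
    real_inner_smul_right, mul_pow, mul_pow, Real.norm_eq_abs, Real.norm_eq_abs, sq_abs, sq_abs,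
    real_inner_comm v u]
  ring

/-- The convex-combination identity gives, for each fixed point `p`, a decrease of `‖x - p‖ ^ 2` by
at least `α * (1 - α) * ‖T x - x‖ ^ 2`, and regularity bounds this residual below by the distance.
-/
lemma QuasiNonexpansive.infDist_relax_sq_le (hT : QuasiNonexpansive T)
    (hne : (Function.fixedPoints T).Nonempty) {κ : ℝ} (hκ : 0 < κ)
    (hreg : LinearlyRegularWith κ T) {α : ℝ} (hα₀ : 0 ≤ α) (hα₁ : α ≤ 1) (x : H) :
    Metric.infDist ((1 - α) • x + α • T x) (Function.fixedPoints T) ^ 2 ≤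
      (1 - α * (1 - α) / κ ^ 2) * Metric.infDist x (Function.fixedPoints T) ^ 2 := by
  set S := Function.fixedPoints T
  set d := Metric.infDist x S with hd
  set d' := Metric.infDist ((1 - α) • x + α • T x) S with hd'
  have hd0 : 0 ≤ d := Metric.infDist_nonneg
  have hd'0 : 0 ≤ d' := Metric.infDist_nonneg
  have hc : 0 ≤ α * (1 - α) := mul_nonneg hα₀ (by linarith)
  have hdT : d ^ 2 / κ ^ 2 ≤ ‖T x - x‖ ^ 2 := by
    rw [← div_pow]
    exact pow_le_pow_left₀ (by positivity) ((div_le_iff₀' hκ).2 (hreg x)) 2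
  have key : ∀ p ∈ S, d' ^ 2 + α * (1 - α) * (d ^ 2 / κ ^ 2) ≤ ‖x - p‖ ^ 2 := fun p hp => by
    have h1 : d' ≤ ‖(1 - α) • (x - p) + α • (T x - p)‖ := by
      have := Metric.infDist_le_dist_of_mem (x := (1 - α) • x + α • T x) hp
      rw [dist_eq_norm] at this
      refine this.trans (le_of_eq ?_)
      congr 1
      module
    have h2 := pow_le_pow_left₀ hd'0 h1 2
    rw [norm_convex_comb_sq, sub_sub_sub_cancel_right] at h2
    have h3 := mul_le_mul_of_nonneg_left (pow_le_pow_left₀ (norm_nonneg _) (hT x p hp) 2) hα₀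
    have h4 := mul_le_mul_of_nonneg_left hdT hc
    nlinarith
  -- The decrease does not depend on `p`, so the infimum over `p` can be taken without a nearest
  -- fixed point.
  have h5 : √(d' ^ 2 + α * (1 - α) * (d ^ 2 / κ ^ 2)) ≤ d := by
    rw [hd, Metric.le_infDist hne]
    intro p hp
    rw [dist_eq_norm]
    exact Real.sqrt_le_iff.2 ⟨norm_nonneg _, key p hp⟩
  have h6 := (Real.sqrt_le_iff.1 h5).2
  have : (1 - α * (1 - α) / κ ^ 2) * d ^ 2 = d ^ 2 - α * (1 - α) * (d ^ 2 / κ ^ 2) := by ring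
  rw [this]
  linarith

lemma QuasiNonexpansive.infDist_relax_le (hT : QuasiNonexpansive T)
    (hne : (Function.fixedPoints T).Nonempty) {κ : ℝ} (hκ : 0 < κ)
    (hreg : LinearlyRegularWith κ T) {α δ : ℝ} (hα₀ : 0 < α) (hδ₀ : 0 < δ) (hα₁ : α < 1 - δ)
    (x : H) :
    Metric.infDist ((1 - α) • x + α • T x) (Function.fixedPoints T) ≤
      (1 - δ * α / (4 * κ ^ 2)) * Metric.infDist x (Function.fixedPoints T) := by
  have h := hT.infDist_relax_sq_le hne hκ hreg hα₀.le (by linarith) x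
  set d := Metric.infDist x (Function.fixedPoints T)
  set d' := Metric.infDist ((1 - α) • x + α • T x) (Function.fixedPoints T)
  have hd0 : 0 ≤ d := Metric.infDist_nonneg
  have hd'0 : 0 ≤ d' := Metric.infDist_nonneg
  set u := δ * α / κ ^ 2 with hu
  have hu0 : 0 < u := by positivity
  have hu4 : δ * α / (4 * κ ^ 2) = u / 4 := by rw [hu]; field_simp
  have hle : u ≤ α * (1 - α) / κ ^ 2 := by
    rw [hu]
    exact div_le_div_of_nonneg_right (by nlinarith) (sq_nonneg _)
  have h1 : d' ^ 2 ≤ (1 - u) * d ^ 2 :=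
    h.trans (mul_le_mul_of_nonneg_right (by linarith) (sq_nonneg _))
  rw [hu4]
  rcases hd0.eq_or_lt with hd | hd
  · rw [← hd] at h1 ⊢
    have : d' = 0 := by nlinarith
    rw [this, mul_zero]
  -- Nonnegativity of `1 - u / 4` is not assumed: for `d > 0` the squared estimate itself forces `u
  -- ≤ 1`.
  · have hu1 : u ≤ 1 := by
      by_contra! hcon
      have : (1 - u) * d ^ 2 < 0 := mul_neg_of_neg_of_pos (by linarith) (by positivity)
      linarith [sq_nonneg d']
    refine le_of_sq_le_sq (h1.trans ?_) (mul_nonneg (by linarith) hd0)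
    rw [mul_pow]
    refine mul_le_mul_of_nonneg_right ?_ (sq_nonneg _)
    nlinarith

/-- The fixed points of an average of quasi-nonexpansive operators with a common fixed point are
their common fixed points. -/
lemma fixedPoints_globalOp {N : ℕ} (hN : 0 < N) {F : Fin N → H → H}
    (hF : ∀ i, QuasiNonexpansive (F i)) (hcommon : (⋂ i, Function.fixedPoints (F i)).Nonempty) :
    Function.fixedPoints (globalOp F) ⊆ ⋂ i, Function.fixedPoints (F i) := by
  intro p hp
  obtain ⟨q, hq⟩ := hcommon
  rw [Set.mem_iInter] at hq
  have hN' : (N : ℝ) ≠ 0 := Nat.cast_ne_zero.2 hN.ne'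
  have hw1 : ∑ _i : Fin N, 1 / (N : ℝ) = 1 := by simp [hN']
  have hmean : ∑ j, (1 / (N : ℝ)) • (F j p - q) = p - q := by
    rw [← Finset.smul_sum, Finset.sum_sub_distrib, smul_sub, Finset.sum_const, Finset.card_univ,
      Fintype.card_fin, ← Nat.cast_smul_eq_nsmul ℝ, smul_smul, one_div_mul_cancel hN', one_smul]
    congr 1
  -- The vectors `F i p - q` have mean `p - q` and norm at most `‖p - q‖`, so their variance is zero
  -- and they all equal `p - q`.
  have h := sum_mul_norm_sub_sq hw1 fun i => F i p - q
  rw [hmean] at h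
  have hle : ∑ i : Fin N, 1 / (N : ℝ) * ‖F i p - q‖ ^ 2 ≤ ‖p - q‖ ^ 2 := by
    calc ∑ i : Fin N, 1 / (N : ℝ) * ‖F i p - q‖ ^ 2 ≤ ∑ i : Fin N, 1 / (N : ℝ) * ‖p - q‖ ^ 2 := by
          refine Finset.sum_le_sum fun i _ => mul_le_mul_of_nonneg_left ?_ (by positivity)
          exact pow_le_pow_left₀ (norm_nonneg _) (hF i p q (hq i)) 2
      _ = ‖p - q‖ ^ 2 := by rw [← Finset.sum_mul, hw1, one_mul]
  have hnn : ∀ i : Fin N, 0 ≤ 1 / (N : ℝ) * ‖F i p - q - (p - q)‖ ^ 2 := fun i => by positivity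
  have h0 : ∑ i : Fin N, 1 / (N : ℝ) * ‖F i p - q - (p - q)‖ ^ 2 = 0 :=
    le_antisymm (by linarith) (Finset.sum_nonneg fun i _ => hnn i)
  refine Set.mem_iInter.2 fun i => ?_
  have h1 := (Finset.sum_eq_zero_iff_of_nonneg fun i _ => hnn i).1 h0 i (Finset.mem_univ i)
  have h2 := (mul_eq_zero.1 h1).resolve_left (by positivity)
  rw [sub_sub_sub_cancel_right] at h2
  exact sub_eq_zero.1 (norm_eq_zero.1 (pow_eq_zero_iff two_ne_zero |>.1 h2))

end Operators

/-! ### One step of the algorithm. -/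

section Recursion

variable {H : Type*} [NormedAddCommGroup H] [InnerProductSpace ℝ H] {N : ℕ}

/-- The deviation from consensus `(I - A_∞) X`. -/
def consensusError (π : Fin N → ℝ) (X : Fin N → H) : Fin N → H :=
  fun i => X i - ∑ j, π j • X j

/-- The deviation `(I - B_∞) Y` of the tracking variables. -/
def trackingError (ν : Fin N → ℝ) (Y : Fin N → H) : Fin N → H :=
  fun i => Y i - ν i • ∑ j, Y j

/-- The rescaled tracking error `D_ν⁻¹ (I - B_∞) Y / N`. -/
noncomputable def scaledError (ν : Fin N → ℝ) (Y : Fin N → H) : Fin N → H :=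
  fun i => (1 / ((N : ℝ) * ν i)) • trackingError ν Y i

variable {G : Digraph (Fin N)} {A B : Matrix (Fin N) (Fin N) ℝ} {π ν : Fin N → ℝ}

lemma sum_pi_smul_consensusError (hπ1 : ∑ i, π i = 1) (X : Fin N → H) :
    ∑ i, π i • consensusError π X i = 0 := by
  simp only [consensusError, smul_sub, Finset.sum_sub_distrib, ← Finset.sum_smul, hπ1, one_smul,
    sub_self]

lemma matAct_sub (P Q : Matrix (Fin N) (Fin N) ℝ) (X : Fin N → H) (i : Fin N) :
    matAct (P - Q) X i = matAct P X i - matAct Q X i := by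
  simp only [matAct, Matrix.sub_apply, sub_smul, Finset.sum_sub_distrib]

lemma matAct_one (X : Fin N → H) (i : Fin N) : matAct 1 X i = X i := by
  simp [matAct, Matrix.one_apply, ite_smul]

lemma IsNetwork.sum_row (h : IsNetwork G A B π ν) (i : Fin N) : ∑ j, A i j = 1 :=
  Matrix.sum_row_of_mem_rowStochastic h.row_stoch i

lemma IsNetwork.sum_col (h : IsNetwork G A B π ν) (j : Fin N) : ∑ i, B i j = 1 :=
  Matrix.sum_col_of_mem_colStochastic h.col_stoch j

lemma IsNetwork.matAct_consensusError (h : IsNetwork G A B π ν) (X : Fin N → H) (i : Fin N) :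
    matAct A (consensusError π X) i = matAct A X i - ∑ j, π j • X j := by
  simp only [matAct, consensusError, smul_sub, Finset.sum_sub_distrib, ← Finset.sum_smul,
    h.sum_row, one_smul]

/-- `Ainf π` annihilates deviations from the mean, so the contracting matrix `A - Ainf π` may act on
them in place of `A`. -/
lemma IsNetwork.matAct_row (h : IsNetwork G A B π ν) (X : Fin N → H) (i : Fin N) :
    matAct A X i = (∑ j, π j • X j) + matAct (A - Ainf π) (consensusError π X) i := by
  have : matAct (Ainf π) (consensusError π X) i = 0 := sum_pi_smul_consensusError h.pi_sum X
  rw [matAct_sub, this, h.matAct_consensusError]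
  abel

lemma IsNetwork.matAct_sub_one (h : IsNetwork G A B π ν) (X : Fin N → H) (i : Fin N) :
    matAct (A - 1) (consensusError π X) i = matAct A X i - X i := by
  rw [matAct_sub, matAct_one, h.matAct_consensusError, consensusError]
  abel

lemma IsNetwork.sum_pi_smul_matAct (h : IsNetwork G A B π ν) (X : Fin N → H) :
    ∑ i, π i • matAct A X i = ∑ j, π j • X j := by
  conv_rhs => rw [← h.pi_eig]
  simp only [matAct, Finset.smul_sum, Matrix.vecMul, dotProduct, Finset.sum_smul, smul_smul]
  rw [Finset.sum_comm]

lemma IsNetwork.sum_matAct (h : IsNetwork G A B π ν) (Y : Fin N → H) :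
    ∑ i, matAct B Y i = ∑ j, Y j := by
  simp only [matAct]
  rw [Finset.sum_comm]
  simp only [← Finset.sum_smul, h.sum_col, one_smul]

lemma IsNetwork.matAct_trackingError (h : IsNetwork G A B π ν) (Y : Fin N → H) (i : Fin N) :
    matAct (B - Binf ν) (trackingError ν Y) i = matAct B Y i - ν i • ∑ j, Y j := by
  have h0 : matAct (Binf ν) (trackingError ν Y) i = 0 := by
    simp only [matAct, Binf, Matrix.of_apply, trackingError, ← Finset.smul_sum,
      Finset.sum_sub_distrib, ← Finset.sum_smul, h.nu_sum, one_smul, sub_self, smul_zero]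
  have h1 := congrFun h.nu_eig i
  simp only [Matrix.mulVec, dotProduct] at h1
  rw [matAct_sub, h0, sub_zero]
  simp only [matAct, trackingError, smul_sub, Finset.sum_sub_distrib, smul_smul,
    ← Finset.sum_smul, h1]

/-- One step of the `x`-update, split into its consensus part and its tracking part. -/
lemma IsNetwork.step_x_eq (h : IsNetwork G A B π ν) {α : ℝ} {x y x' : Fin N → H}
    (hx : ∀ i, x' i = (∑ j, A i j • x j) +
      α • ((1 / ((N : ℝ) * ν i)) • y i - ∑ j, A i j • x j)) (i : Fin N) :
    x' i = (1 - α) • matAct A x i + α • ((1 / (N : ℝ)) • ∑ j, y j + scaledError ν y i) := by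
  have h1 : (1 / ((N : ℝ) * ν i)) • y i = (1 / (N : ℝ)) • (∑ j, y j) + scaledError ν y i := by
    have : 1 / ((N : ℝ) * ν i) * ν i = 1 / (N : ℝ) := by
      rw [one_div, mul_inv, mul_assoc, inv_mul_cancel₀ (h.nu_pos i).ne', mul_one, one_div]
    rw [scaledError, trackingError, smul_sub, smul_smul, this]
    abel
  rw [hx, h1, matAct]
  module

lemma IsNetwork.mean_step (h : IsNetwork G A B π ν) {α : ℝ} {x y x' : Fin N → H}
    (hx : ∀ i, x' i = (∑ j, A i j • x j) +
      α • ((1 / ((N : ℝ) * ν i)) • y i - ∑ j, A i j • x j)) :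
    ∑ i, π i • x' i = (1 - α) • (∑ i, π i • x i) +
      α • ((1 / (N : ℝ)) • (∑ j, y j) + ∑ i, π i • scaledError ν y i) := by
  simp only [h.step_x_eq hx, smul_add, Finset.sum_add_distrib, smul_comm (π _), ← Finset.smul_sum,
    h.sum_pi_smul_matAct, ← Finset.sum_smul, h.pi_sum, one_smul]

/-- The average of the `y j` enters every node alike and cancels against the mean; only its scaled
error survives. -/
lemma IsNetwork.consensusError_step_le (h : IsNetwork G A B π ν) (hN : 0 < N) {α : ℝ}
    (hα₀ : 0 ≤ α) (hα₁ : α ≤ 1) {x y x' : Fin N → H}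
    (hx : ∀ i, x' i = (∑ j, A i j • x j) +
      α • ((1 / ((N : ℝ) * ν i)) • y i - ∑ j, A i j • x j)) :
    wnorm π (consensusError π x') ≤
      (1 - α) * (inducedNorm (piNorm π) (A - Ainf π) * wnorm π (consensusError π x)) +
        α * wnorm π (scaledError ν y) := by
  have hπ := fun i => (h.pi_pos i).le
  have heq : consensusError π x' = fun i =>
      (1 - α) • matAct (A - Ainf π) (consensusError π x) i +
        α • consensusError π (scaledError ν y) i := by
    ext i
    rw [consensusError, h.mean_step hx, h.step_x_eq hx, h.matAct_row x i]
    simp only [consensusError]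
    module
  rw [heq]
  refine (wnorm_add_le hπ _ _).trans ?_
  rw [wnorm_smul, wnorm_smul, abs_of_nonneg hα₀, abs_of_nonneg (by linarith : 0 ≤ 1 - α)]
  exact add_le_add (mul_le_mul_of_nonneg_left (h.wnorm_matAct_row_le hN _) (by linarith))
    (mul_le_mul_of_nonneg_left (wnorm_sub_mean_le h.pi_sum _) hα₀)

lemma IsNetwork.trackingError_step_le (h : IsNetwork G A B π ν) (hN : 0 < N)
    {y y' φ : Fin N → H} (hy : ∀ i, y' i = (∑ j, B i j • y j) + φ i) :
    wnorm (fun i => (ν i)⁻¹) (trackingError ν y') ≤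
      inducedNorm (nuNorm ν) (B - Binf ν) * wnorm (fun i => (ν i)⁻¹) (trackingError ν y) +
        wnorm (fun i => (ν i)⁻¹) φ := by
  have hν := fun i => (inv_pos.2 (h.nu_pos i)).le
  have hsum : ∑ j, y' j = (∑ j, y j) + ∑ j, φ j := by
    simp only [hy, Finset.sum_add_distrib]
    congr 1
    exact h.sum_matAct y
  have heq : trackingError ν y' = fun i =>
      matAct (B - Binf ν) (trackingError ν y) i + trackingError ν φ i := by
    ext i
    rw [h.matAct_trackingError, trackingError, hsum]
    simp only [trackingError, hy, matAct]
    module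
  rw [heq]
  exact (wnorm_add_le hν _ _).trans (add_le_add (h.wnorm_matAct_col_le hN _)
    (wnorm_inv_sub_smul_sum_le h.nu_pos h.nu_sum _))

lemma IsNetwork.step_x_sub_le (h : IsNetwork G A B π ν) {α : ℝ}
    (hα₀ : 0 ≤ α) {x y x' : Fin N → H}
    (hx : ∀ i, x' i = (∑ j, A i j • x j) +
      α • ((1 / ((N : ℝ) * ν i)) • y i - ∑ j, A i j • x j)) :
    wnorm (fun _ => 1) (fun i => x' i - x i) ≤
      l2Norm (A - 1) * wnorm (fun _ => 1) (consensusError π x) +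
        α * (wnorm (fun _ => 1) (matAct (A - Ainf π) (consensusError π x)) +
          √N * ‖(1 / (N : ℝ)) • (∑ j, y j) - ∑ j, π j • x j‖ +
          wnorm (fun _ => 1) (scaledError ν y)) := by
  have h1 : ∀ i : Fin N, (0 : ℝ) ≤ (fun _ => 1 : Fin N → ℝ) i := fun _ => zero_le_one
  have heq : (fun i => x' i - x i) = fun i => matAct (A - 1) (consensusError π x) i +
      α • (((-1 : ℝ) • matAct (A - Ainf π) (consensusError π x) i +
        ((1 / (N : ℝ)) • (∑ j, y j) - ∑ j, π j • x j)) + scaledError ν y i) := by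
    ext i
    rw [h.step_x_eq hx, h.matAct_sub_one, h.matAct_row x i]
    module
  rw [heq]
  refine (wnorm_add_le h1 _ _).trans (add_le_add (wnorm_matAct_le_l2Norm _ _) ?_)
  rw [wnorm_smul, abs_of_nonneg hα₀]
  refine mul_le_mul_of_nonneg_left ((wnorm_add_le h1 _ _).trans ?_) hα₀
  gcongr
  refine (wnorm_add_le h1 _ _).trans ?_
  rw [wnorm_smul, abs_neg, abs_one, one_mul, wnorm_const]
  simp

lemma norm_scaledError_le (hν : ∀ i, 0 < ν i) (Y : Fin N → H) (i : Fin N) :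
    ‖scaledError ν Y i‖ ≤ l2Norm ((Matrix.diagonal ν)⁻¹) / N * ‖trackingError ν Y i‖ := by
  rw [scaledError, norm_smul, Real.norm_eq_abs, abs_of_nonneg (by have := hν i; positivity)]
  refine mul_le_mul_of_nonneg_right ?_ (norm_nonneg _)
  rw [mul_comm, ← div_div, one_div]
  exact div_le_div_of_nonneg_right (inv_le_l2Norm_inv_diagonal hν i) (Nat.cast_nonneg _)

/-- The factor `√N` on the left offsets the `1 / N` of the average and the `√N` lost in
Cauchy–Schwarz. -/
lemma norm_avg_sub_globalOp_le {F : Fin N → H → H} {L : Fin N → ℝ≥0}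
    (hL : ∀ i, LipschitzWith (L i) (F i)) {π : Fin N → ℝ} (x : Fin N → H) :
    √N * ‖(1 / (N : ℝ)) • (∑ i, F i (x i)) - globalOp F (∑ j, π j • x j)‖ ≤
      ((Finset.univ.sup L : ℝ≥0) : ℝ) * wnorm (fun _ => 1) (consensusError π x) := by
  rcases Nat.eq_zero_or_pos N with hN | hN
  · subst hN
    simp [wnorm]
  have hN' : (0 : ℝ) < N := Nat.cast_pos.2 hN
  set Lb := ((Finset.univ.sup L : ℝ≥0) : ℝ) with hLb
  have hLb0 : 0 ≤ Lb := NNReal.coe_nonneg _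
  have h1 : ∀ i, ‖F i (x i) - F i (∑ j, π j • x j)‖ ≤ Lb * ‖consensusError π x i‖ := fun i => by
    refine ((hL i).norm_sub_le _ _).trans (mul_le_mul_of_nonneg_right ?_ (norm_nonneg _))
    exact NNReal.coe_le_coe.2 (Finset.le_sup (Finset.mem_univ i))
  have hs := Real.sq_sqrt hN'.le
  have hs0 : 0 < √(N : ℝ) := Real.sqrt_pos.2 hN'
  calc √N * ‖(1 / (N : ℝ)) • (∑ i, F i (x i)) - globalOp F (∑ j, π j • x j)‖
      = √N * (1 / N * ‖∑ i, (F i (x i) - F i (∑ j, π j • x j))‖) := by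
        rw [globalOp, ← smul_sub, ← Finset.sum_sub_distrib, norm_smul, Real.norm_eq_abs,
          abs_of_nonneg (by positivity)]
    _ ≤ √N * (1 / N * (Lb * (√N * wnorm (fun _ => 1) (consensusError π x)))) := by
        gcongr
        refine (norm_sum_le_of_le _ fun i _ => h1 i).trans ?_
        rw [← Finset.mul_sum]
        exact mul_le_mul_of_nonneg_left (sum_norm_le _) hLb0
    _ = √N ^ 2 / N * (Lb * wnorm (fun _ => 1) (consensusError π x)) := by ring
    _ = _ := by rw [hs, div_self hN'.ne', one_mul]

/-- The point `v` is free: `v = globalOp F m` gives the distance recursion, `v = m` the increments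
of the means. -/
lemma IsNetwork.mean_step_sub_le (h : IsNetwork G A B π ν) {α : ℝ}
    (hα₀ : 0 ≤ α) {x y x' : Fin N → H}
    (hx : ∀ i, x' i = (∑ j, A i j • x j) +
      α • ((1 / ((N : ℝ) * ν i)) • y i - ∑ j, A i j • x j)) (v : H) :
    ‖∑ i, π i • x' i - ((1 - α) • (∑ i, π i • x i) + α • v)‖ ≤
      α * (‖(1 / (N : ℝ)) • (∑ j, y j) - v‖ + wnorm π (scaledError ν y)) := by
  have heq : ∑ i, π i • x' i - ((1 - α) • (∑ i, π i • x i) + α • v) =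
      α • (((1 / (N : ℝ)) • (∑ j, y j) - v) + ∑ i, π i • scaledError ν y i) := by
    rw [h.mean_step hx]
    module
  rw [heq, norm_smul, Real.norm_eq_abs, abs_of_nonneg hα₀]
  exact mul_le_mul_of_nonneg_left ((norm_add_le _ _).trans
    (add_le_add le_rfl (norm_mean_le (fun i => (h.pi_pos i).le) h.pi_sum _))) hα₀

/-- The conservation law of tracking: `B` preserves sums and the increments telescope from `y 0 i =
F i (x 0 i)`. -/
lemma IsDOTSequence.sum_y {F : Fin N → H → H} {α : ℝ} {x y : ℕ → Fin N → H}
    (hs : IsDOTSequence A B ν F α x y) (h : IsNetwork G A B π ν) (k : ℕ) :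
    ∑ i, y k i = ∑ i, F i (x k i) := by
  induction k with
  | zero => simp only [hs.init]
  | succ k ih =>
    have := h.sum_matAct (y k)
    simp only [matAct] at this
    simp only [hs.step_y, Finset.sum_add_distrib, Finset.sum_sub_distrib, this, ih]
    abel

end Recursion
-- Norm-equivalence constants.
section Constants

variable {E : Type*} [NormedAddCommGroup E] [InnerProductSpace ℝ E] {N : ℕ}
  {G : Digraph (Fin N)} {A B : Matrix (Fin N) (Fin N) ℝ} {π ν : Fin N → ℝ} {c₁ c₂ c₃ c₄ : ℝ}

lemma NormConstants.wnorm_one_le (hc : NormConstants π ν c₁ c₂ c₃ c₄)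
    (h : IsNetwork G A B π ν) (X : Fin N → E) :
    wnorm (fun _ => 1) X ≤ wnorm π X / c₁ := by
  rw [div_eq_inv_mul]
  refine wnorm_le_of_scalar (fun _ => zero_le_one) (fun i => (h.pi_pos i).le)
    (inv_nonneg.2 hc.pos₁.le) (fun x => ?_) X
  rw [← div_eq_inv_mul, le_div_iff₀' hc.pos₁]
  simpa only [norm_eq_wnorm, piNorm_eq_wnorm] using hc.le₁ (WithLp.toLp 2 x)

lemma NormConstants.wnorm_pi_le (hc : NormConstants π ν c₁ c₂ c₃ c₄)
    (h : IsNetwork G A B π ν) (X : Fin N → E) :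
    wnorm π X ≤ c₂ * wnorm (fun _ => 1) X := by
  refine wnorm_le_of_scalar (fun i => (h.pi_pos i).le) (fun _ => zero_le_one) hc.pos₂.le
    (fun x => ?_) X
  simpa only [norm_eq_wnorm, piNorm_eq_wnorm] using hc.le₂ (WithLp.toLp 2 x)

lemma NormConstants.wnorm_inv_le (hc : NormConstants π ν c₁ c₂ c₃ c₄)
    (h : IsNetwork G A B π ν) (X : Fin N → E) :
    wnorm (fun i => (ν i)⁻¹) X ≤ wnorm π X / c₃ := by
  rw [div_eq_inv_mul]
  refine wnorm_le_of_scalar (fun i => (inv_pos.2 (h.nu_pos i)).le) (fun i => (h.pi_pos i).le)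
    (inv_nonneg.2 hc.pos₃.le) (fun x => ?_) X
  rw [← div_eq_inv_mul, le_div_iff₀' hc.pos₃]
  simpa only [nuNorm_eq_wnorm, piNorm_eq_wnorm] using hc.le₃ x

lemma NormConstants.wnorm_pi_le_inv (hc : NormConstants π ν c₁ c₂ c₃ c₄)
    (h : IsNetwork G A B π ν) (X : Fin N → E) :
    wnorm π X ≤ c₄ * wnorm (fun i => (ν i)⁻¹) X := by
  refine wnorm_le_of_scalar (fun i => (h.pi_pos i).le) (fun i => (inv_pos.2 (h.nu_pos i)).le)
    hc.pos₄.le (fun x => ?_) X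
  simpa only [nuNorm_eq_wnorm, piNorm_eq_wnorm] using hc.le₄ x

/-- Tested on the constant vector `1`, of π-norm `1` and Euclidean norm `√N`. -/
lemma NormConstants.one_le_mul_sqrt (hc : NormConstants π ν c₁ c₂ c₃ c₄)
    (h : IsNetwork G A B π ν) : 1 ≤ c₂ * √N := by
  have := hc.wnorm_pi_le h (fun _ => (1 : ℝ))
  rw [wnorm_const, wnorm_const, h.pi_sum] at this
  simpa using this

lemma NormConstants.sqrt_le_one_div (hc : NormConstants π ν c₁ c₂ c₃ c₄)
    (h : IsNetwork G A B π ν) : √N ≤ 1 / c₁ := by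
  have := hc.wnorm_one_le h (fun _ => (1 : ℝ))
  rw [wnorm_const, wnorm_const, h.pi_sum] at this
  simpa using this

lemma wnorm_pi_scaledError_le (hc : NormConstants π ν c₁ c₂ c₃ c₄)
    (h : IsNetwork G A B π ν) (Y : Fin N → E) :
    wnorm π (scaledError ν Y) ≤ c₄ * l2Norm ((Matrix.diagonal ν)⁻¹) / N *
      wnorm (fun i => (ν i)⁻¹) (trackingError ν Y) := by
  have h0 : 0 ≤ l2Norm ((Matrix.diagonal ν)⁻¹) / N := div_nonneg (norm_nonneg _) (Nat.cast_nonneg _)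
  refine (wnorm_le_of_norm_le (fun i => (h.pi_pos i).le) h0
    (norm_scaledError_le h.nu_pos Y)).trans ?_
  refine (mul_le_mul_of_nonneg_left (hc.wnorm_pi_le_inv h _) h0).trans (le_of_eq (by ring))

end Constants

/-! ### The error recursion and the limit. -/

section System

variable {H : Type*} [NormedAddCommGroup H] [InnerProductSpace ℝ H] {N : ℕ}
  {G : Digraph (Fin N)} {A B : Matrix (Fin N) (Fin N) ℝ} {π ν : Fin N → ℝ} {c₁ c₂ c₃ c₄ α : ℝ}
  {F : Fin N → H → H} {L : Fin N → ℝ≥0} {x y : ℕ → Fin N → H}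

/-- The first row of the error recursion. -/
lemma IsDOTSequence.consensus_le (hs : IsDOTSequence A B ν F α x y) (h : IsNetwork G A B π ν)
    (hN : 0 < N) (hc : NormConstants π ν c₁ c₂ c₃ c₄) (hα₀ : 0 ≤ α) (hα₁ : α ≤ 1) (k : ℕ) :
    wnorm π (consensusError π (x (k + 1))) ≤
      (1 - α) * inducedNorm (piNorm π) (A - Ainf π) * wnorm π (consensusError π (x k)) +
      α * c₂ * (c₄ * l2Norm ((Matrix.diagonal ν)⁻¹) / N) *
        ((√N + 1) * wnorm (fun i => (ν i)⁻¹) (trackingError ν (y k))) := by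
  have h1 := h.consensusError_step_le hN hα₀ hα₁ (hs.step_x k)
  have h2 := wnorm_pi_scaledError_le hc h (y k)
  set τ := wnorm (fun i => (ν i)⁻¹) (trackingError ν (y k)) with hτ
  have hτ0 : 0 ≤ τ := wnorm_nonneg _ _
  set θ := c₄ * l2Norm ((Matrix.diagonal ν)⁻¹) / N
  have hθ : 0 ≤ θ := div_nonneg (mul_nonneg hc.pos₄.le (norm_nonneg _)) (Nat.cast_nonneg _)
  -- This slack inserts the factor `c₂` of the step matrix together with the scaling `√N + 1` of the
  -- second error.
  have h3 : 1 ≤ c₂ * (√N + 1) := by linarith [hc.one_le_mul_sqrt h, hc.pos₂]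
  have h4 : α * wnorm π (scaledError ν (y k)) ≤ α * c₂ * θ * ((√N + 1) * τ) := by
    calc α * wnorm π (scaledError ν (y k)) ≤ 1 * (α * (θ * τ)) := by
          rw [one_mul]; exact mul_le_mul_of_nonneg_left h2 hα₀
      _ ≤ (c₂ * (√N + 1)) * (α * (θ * τ)) :=
          mul_le_mul_of_nonneg_right h3 (mul_nonneg hα₀ (mul_nonneg hθ hτ0))
      _ = _ := by ring
  refine h1.trans (add_le_add (le_of_eq (by ring)) h4)

lemma IsDOTSequence.avg_sub_mean_le (hs : IsDOTSequence A B ν F α x y) (h : IsNetwork G A B π ν)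
    (hL : ∀ i, LipschitzWith (L i) (F i)) (hc : NormConstants π ν c₁ c₂ c₃ c₄) (k : ℕ) :
    √N * ‖(1 / (N : ℝ)) • (∑ j, y k j) - globalOp F (∑ j, π j • x k j)‖ ≤
      ((Finset.univ.sup L : ℝ≥0) : ℝ) * (wnorm π (consensusError π (x k)) / c₁) := by
  rw [hs.sum_y h]
  exact (norm_avg_sub_globalOp_le hL (x k)).trans
    (mul_le_mul_of_nonneg_left (hc.wnorm_one_le h _) (NNReal.coe_nonneg _))

/-- The second row of the error recursion. -/
lemma IsDOTSequence.tracking_le (hs : IsDOTSequence A B ν F α x y) (h : IsNetwork G A B π ν)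
    (hN : 0 < N) (hL : ∀ i, LipschitzWith (L i) (F i)) (hF : QuasiNonexpansive (globalOp F))
    (hFix : (Function.fixedPoints (globalOp F)).Nonempty)
    (hc : NormConstants π ν c₁ c₂ c₃ c₄) (hα₀ : 0 ≤ α) {θ₁ θ₂ Lb : ℝ}
    (hLb : Lb = ((Finset.univ.sup L : ℝ≥0) : ℝ))
    (hθ₁ : θ₁ = c₄ * l2Norm ((Matrix.diagonal ν)⁻¹) / N)
    (hθ₂ : θ₂ = c₂ * Lb * (√N + 1) / (c₁ * c₃)) (k : ℕ) :
    (√N + 1) * wnorm (fun i => (ν i)⁻¹) (trackingError ν (y (k + 1))) ≤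
      θ₂ * (α * (inducedNorm (piNorm π) (A - Ainf π) + Lb) + l2Norm (A - 1)) *
        wnorm π (consensusError π (x k)) +
      (inducedNorm (nuNorm ν) (B - Binf ν) + α * θ₁ * θ₂) *
        ((√N + 1) * wnorm (fun i => (ν i)⁻¹) (trackingError ν (y k))) +
      2 * α * c₁ * θ₂ *
        (√N * Metric.infDist (∑ j, π j • x k j) (Function.fixedPoints (globalOp F))) := by
  have e1 := h.trackingError_step_le hN (φ := fun i => F i (x (k + 1) i) - F i (x k i))
    (fun i => by rw [hs.step_y]; abel : ∀ i, y (k + 1) i = (∑ j, B i j • y k j) + _)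
  have e2 := h.step_x_sub_le hα₀ (hs.step_x k)
  have e3 := hs.avg_sub_mean_le h hL hc k
  have e4 := hF.norm_sub_le_two_mul_infDist hFix (∑ j, π j • x k j)
  have e5 := hc.wnorm_one_le h (scaledError ν (y k))
  have e6 := wnorm_pi_scaledError_le hc h (y k)
  have e7 := (hc.wnorm_one_le h (matAct (A - Ainf π) (consensusError π (x k)))).trans
    (div_le_div_of_nonneg_right (h.wnorm_matAct_row_le hN _) hc.pos₁.le)
  have e8 := hc.wnorm_one_le h (consensusError π (x k))
  rw [← hθ₁] at e6
  rw [← hLb] at e3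
  have hLb0 : 0 ≤ Lb := hLb ▸ NNReal.coe_nonneg _
  have p1 := hc.pos₁
  have p2 := hc.pos₂
  have p3 := hc.pos₃
  have hθ₁0 : 0 ≤ θ₁ := by
    rw [hθ₁]
    exact div_nonneg (mul_nonneg hc.pos₄.le (norm_nonneg _)) (Nat.cast_nonneg _)
  have hθ₂0 : 0 ≤ θ₂ := by rw [hθ₂]; positivity
  have hsq : 0 ≤ √(N : ℝ) := Real.sqrt_nonneg _
  have e9 : wnorm (fun i => (ν i)⁻¹) (fun i => F i (x (k + 1) i) - F i (x k i)) ≤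
      c₂ * Lb / c₃ * wnorm (fun _ => 1) (fun i => x (k + 1) i - x k i) := by
    refine (hc.wnorm_inv_le h _).trans ?_
    rw [div_mul_eq_mul_div]
    refine div_le_div_of_nonneg_right ((hc.wnorm_pi_le h _).trans ?_) p3.le
    rw [mul_assoc]
    refine mul_le_mul_of_nonneg_left
      (wnorm_le_of_norm_le (fun _ => zero_le_one) hLb0 fun i => ?_) p2.le
    refine ((hL i).norm_sub_le _ _).trans (mul_le_mul_of_nonneg_right ?_ (norm_nonneg _))
    rw [hLb]
    exact NNReal.coe_le_coe.2 (Finset.le_sup (Finset.mem_univ i))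
  set m := ∑ j, π j • x k j
  set u := (1 / (N : ℝ)) • (∑ j, y k j)
  set s := wnorm π (consensusError π (x k))
  set τ := wnorm (fun i => (ν i)⁻¹) (trackingError ν (y k))
  set τ' := wnorm (fun i => (ν i)⁻¹) (trackingError ν (y (k + 1)))
  set D := Metric.infDist m (Function.fixedPoints (globalOp F))
  set ρ₁ := inducedNorm (piNorm π) (A - Ainf π)
  set ρ₂ := inducedNorm (nuNorm ν) (B - Binf ν)
  have hτ0 : 0 ≤ τ := wnorm_nonneg _ _
  have hθ₄ : 0 ≤ l2Norm (A - 1) := norm_nonneg _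
  set θ₄ := l2Norm (A - 1)
  -- Passing through `globalOp F m` splits the difference into a Lipschitz error and a residual of
  -- at most `2 * D`.
  have f1 : √N * ‖u - m‖ ≤ Lb * (s / c₁) + √N * (2 * D) := by
    have : ‖u - m‖ ≤ ‖u - globalOp F m‖ + ‖globalOp F m - m‖ := norm_sub_le_norm_sub_add_norm_sub ..
    calc √N * ‖u - m‖ ≤ √N * (‖u - globalOp F m‖ + ‖globalOp F m - m‖) := by gcongr
      _ = √N * ‖u - globalOp F m‖ + √N * ‖globalOp F m - m‖ := by ring
      _ ≤ _ := by gcongr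
  have f2 : wnorm (fun _ => 1) (scaledError ν (y k)) ≤ θ₁ * τ / c₁ :=
    e5.trans (div_le_div_of_nonneg_right e6 p1.le)
  have f3 : wnorm (fun _ => 1) (fun i => x (k + 1) i - x k i) ≤
      θ₄ * (s / c₁) + α * (ρ₁ * s / c₁ + (Lb * (s / c₁) + √N * (2 * D)) + θ₁ * τ / c₁) := by
    refine e2.trans ?_
    gcongr
  have f4 : τ' ≤ ρ₂ * τ + c₂ * Lb / c₃ *
      (θ₄ * (s / c₁) + α * (ρ₁ * s / c₁ + (Lb * (s / c₁) + √N * (2 * D)) + θ₁ * τ / c₁)) := by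
    refine e1.trans ?_
    refine add_le_add le_rfl (e9.trans ?_)
    gcongr
  calc (√N + 1) * τ' ≤ (√N + 1) * (ρ₂ * τ + c₂ * Lb / c₃ *
      (θ₄ * (s / c₁) + α * (ρ₁ * s / c₁ + (Lb * (s / c₁) + √N * (2 * D)) + θ₁ * τ / c₁))) := by
        gcongr
    _ = θ₂ * (α * (ρ₁ + Lb) + θ₄) * s + (ρ₂ * ((√N + 1) * τ) + α * θ₁ * θ₂ * τ) +
        2 * α * c₁ * θ₂ * (√N * D) := by
        rw [hθ₂]
        field_simp
        ring
    _ ≤ _ := by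
        have : τ ≤ (√N + 1) * τ := le_mul_of_one_le_left hτ0 (by linarith)
        rw [add_mul ρ₂]
        gcongr

/-- The third row of the error recursion. -/
lemma IsDOTSequence.dist_le (hs : IsDOTSequence A B ν F α x y) (h : IsNetwork G A B π ν)
    (hN : 0 < N) (hL : ∀ i, LipschitzWith (L i) (F i)) (hF : QuasiNonexpansive (globalOp F))
    (hFix : (Function.fixedPoints (globalOp F)).Nonempty)
    (hc : NormConstants π ν c₁ c₂ c₃ c₄) {κ δ : ℝ} (hκ : 0 < κ)
    (hreg : LinearlyRegularWith κ (globalOp F)) (hδ₀ : 0 < δ) (hα₀ : 0 < α) (hα₁ : α < 1 - δ)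
    {θ₁ Lb : ℝ} (hLb : Lb = ((Finset.univ.sup L : ℝ≥0) : ℝ))
    (hθ₁ : θ₁ = c₄ * l2Norm ((Matrix.diagonal ν)⁻¹) / N) (k : ℕ) :
    √N * Metric.infDist (∑ j, π j • x (k + 1) j) (Function.fixedPoints (globalOp F)) ≤
      α * Lb / c₁ * wnorm π (consensusError π (x k)) +
      α * √N * θ₁ / c₁ * ((√N + 1) * wnorm (fun i => (ν i)⁻¹) (trackingError ν (y k))) +
      (1 - δ * α / (4 * κ ^ 2)) *
        (√N * Metric.infDist (∑ j, π j • x k j) (Function.fixedPoints (globalOp F))) := by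
  have e1 := h.mean_step_sub_le hα₀.le (hs.step_x k) (globalOp F (∑ j, π j • x k j))
  have e2 := hF.infDist_relax_le hFix hκ hreg hα₀ hδ₀ hα₁ (∑ j, π j • x k j)
  have e3 := hs.avg_sub_mean_le h hL hc k
  have e6 := wnorm_pi_scaledError_le hc h (y k)
  rw [← hθ₁] at e6
  rw [← hLb] at e3
  have p1 := hc.pos₁
  have hθ₁0 : 0 ≤ θ₁ := by
    rw [hθ₁]
    exact div_nonneg (mul_nonneg hc.pos₄.le (norm_nonneg _)) (Nat.cast_nonneg _)
  have hsq : 1 ≤ √(N : ℝ) := Real.one_le_sqrt.2 (by exact_mod_cast hN)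
  have hc1 := hc.sqrt_le_one_div h
  have e7 := Metric.infDist_le_infDist_add_dist (s := Function.fixedPoints (globalOp F))
    (x := ∑ j, π j • x (k + 1) j)
    (y := (1 - α) • (∑ j, π j • x k j) + α • globalOp F (∑ j, π j • x k j))
  rw [dist_eq_norm] at e7
  set m := ∑ j, π j • x k j
  set m' := ∑ j, π j • x (k + 1) j
  set u := (1 / (N : ℝ)) • (∑ j, y k j)
  set s := wnorm π (consensusError π (x k))
  set τ := wnorm (fun i => (ν i)⁻¹) (trackingError ν (y k))
  set D := Metric.infDist m (Function.fixedPoints (globalOp F))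
  have hτ0 : 0 ≤ τ := wnorm_nonneg _ _
  have f1 : Metric.infDist m' (Function.fixedPoints (globalOp F)) ≤
      (1 - δ * α / (4 * κ ^ 2)) * D + α * (‖u - globalOp F m‖ + θ₁ * τ) := by
    refine e7.trans (add_le_add e2 (e1.trans ?_))
    gcongr
  calc √N * Metric.infDist m' (Function.fixedPoints (globalOp F))
      ≤ √N * ((1 - δ * α / (4 * κ ^ 2)) * D + α * (‖u - globalOp F m‖ + θ₁ * τ)) := by gcongr
    -- The two factors `1` mark the places where `1 ≤ 1 / c₁` and `1 ≤ √N + 1` are inserted next.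
    _ = α * (√N * ‖u - globalOp F m‖) + α * √N * θ₁ * (1 * (1 * τ)) +
        (1 - δ * α / (4 * κ ^ 2)) * (√N * D) := by ring
    _ ≤ α * (Lb * (s / c₁)) + α * √N * θ₁ * (1 / c₁ * ((√N + 1) * τ)) +
        (1 - δ * α / (4 * κ ^ 2)) * (√N * D) := by
        gcongr
        · exact hsq.trans hc1
        · linarith
    _ = _ := by ring

/-- If the three errors decay geometrically, the iterates converge geometrically to a fixed point
of the global operator. -/
lemma IsDOTSequence.exists_limit [CompleteSpace H] (hs : IsDOTSequence A B ν F α x y)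
    (h : IsNetwork G A B π ν)
    (hN : 0 < N) (hL : ∀ i, LipschitzWith (L i) (F i)) (hF : QuasiNonexpansive (globalOp F))
    (hFix : (Function.fixedPoints (globalOp F)).Nonempty)
    (hc : NormConstants π ν c₁ c₂ c₃ c₄) (hα₀ : 0 ≤ α) {r K : ℝ} (hr₀ : 0 < r) (hr₁ : r < 1)
    (hK : ∀ k, wnorm π (consensusError π (x k)) ≤ K * r ^ k ∧
      (√N + 1) * wnorm (fun i => (ν i)⁻¹) (trackingError ν (y k)) ≤ K * r ^ k ∧
      √N * Metric.infDist (∑ j, π j • x k j) (Function.fixedPoints (globalOp F)) ≤ K * r ^ k) :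
    ∃ p ∈ Function.fixedPoints (globalOp F), ∃ C : ℝ, ∀ (k : ℕ) (i : Fin N),
      ‖x k i - p‖ ≤ C * r ^ k := by
  have p1 := hc.pos₁
  have hsq : 1 ≤ √(N : ℝ) := Real.one_le_sqrt.2 (by exact_mod_cast hN)
  obtain ⟨Lb, hLb⟩ : ∃ Lb, Lb = ((Finset.univ.sup L : ℝ≥0) : ℝ) := ⟨_, rfl⟩
  obtain ⟨θ, hθ⟩ : ∃ θ, θ = c₄ * l2Norm ((Matrix.diagonal ν)⁻¹) / N := ⟨_, rfl⟩
  have hLb0 : 0 ≤ Lb := hLb ▸ NNReal.coe_nonneg _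
  have hθ0 : 0 ≤ θ := by
    rw [hθ]
    exact div_nonneg (mul_nonneg hc.pos₄.le (norm_nonneg _)) (Nat.cast_nonneg _)
  set m : ℕ → H := fun k => ∑ j, π j • x k j with hm
  have hdist : ∀ k, Metric.infDist (m k) (Function.fixedPoints (globalOp F)) ≤ K * r ^ k :=
    fun k => (le_mul_of_one_le_left Metric.infDist_nonneg hsq).trans (hK k).2.2
  set Q := α * (Lb / c₁ + 2 + θ) * K with hQ
  have hstep : ∀ k, dist (m k) (m (k + 1)) ≤ Q * r ^ k := fun k => by
    -- With `v = m k` the relaxed point is `m k` itself, so this bounds the increment of the mean.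
    have e1 := h.mean_step_sub_le hα₀ (hs.step_x k) (m k)
    have e2 : (1 - α) • (∑ i, π i • x k i) + α • m k = m k := by
      simp only [hm]; module
    rw [e2] at e1
    have e3 := hs.avg_sub_mean_le h hL hc k
    have e4 := hF.norm_sub_le_two_mul_infDist hFix (m k)
    have e6 := wnorm_pi_scaledError_le hc h (y k)
    rw [← hθ] at e6
    rw [← hLb] at e3
    obtain ⟨k1, k2, -⟩ := hK k
    have k3 := hdist k
    set u := (1 / (N : ℝ)) • (∑ j, y k j)
    have hτ0 : 0 ≤ wnorm (fun i => (ν i)⁻¹) (trackingError ν (y k)) := wnorm_nonneg _ _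
    have k2' : wnorm (fun i => (ν i)⁻¹) (trackingError ν (y k)) ≤ K * r ^ k :=
      (le_mul_of_one_le_left hτ0 (by linarith)).trans k2
    have f1 : ‖u - globalOp F (m k)‖ ≤ Lb * (K * r ^ k / c₁) :=
      ((le_mul_of_one_le_left (norm_nonneg _) hsq).trans e3).trans (by gcongr)
    have f2 : ‖u - m k‖ ≤ ‖u - globalOp F (m k)‖ + ‖globalOp F (m k) - m k‖ :=
      norm_sub_le_norm_sub_add_norm_sub ..
    rw [dist_comm, dist_eq_norm]
    refine e1.trans ?_
    calc α * (‖u - m k‖ + wnorm π (scaledError ν (y k)))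
        ≤ α * ((Lb * (K * r ^ k / c₁) + 2 * (K * r ^ k)) + θ * (K * r ^ k)) := by
          refine mul_le_mul_of_nonneg_left (add_le_add ?_ (e6.trans ?_)) hα₀
          · linarith
          · gcongr
      _ = Q * r ^ k := by rw [hQ]; ring
  obtain ⟨p, hp⟩ := cauchySeq_tendsto_of_complete (cauchySeq_of_le_geometric r Q hr₁ hstep)
  have hlim := dist_le_of_le_geometric_of_tendsto r Q hr₁ hstep hp
  have hcont : Continuous (globalOp F) := by
    unfold globalOp
    exact (continuous_finsetSum _ fun i _ => (hL i).continuous).const_smul _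
  have hclosed : IsClosed (Function.fixedPoints (globalOp F)) :=
    isClosed_fixedPoints hcont
  have hp0 : Metric.infDist p (Function.fixedPoints (globalOp F)) = 0 := by
    have t1 := ((Metric.continuous_infDist_pt
      (Function.fixedPoints (globalOp F))).tendsto p).comp hp
    have t2 : Filter.Tendsto (fun k : ℕ => K * r ^ k) Filter.atTop (nhds 0) := by
      simpa using (tendsto_pow_atTop_nhds_zero_of_lt_one hr₀.le hr₁).const_mul K
    exact le_antisymm (le_of_tendsto_of_tendsto' t1 t2 hdist) Metric.infDist_nonneg
  refine ⟨p, (hclosed.mem_iff_infDist_zero hFix).2 hp0, K / c₁ + Q / (1 - r), fun k i => ?_⟩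
  have e1 : ‖x k i - m k‖ ≤ K * r ^ k / c₁ :=
    (norm_le_wnorm_one (consensusError π (x k)) i).trans ((hc.wnorm_one_le h _).trans
      (div_le_div_of_nonneg_right (hK k).1 p1.le))
  have e2 := hlim k
  rw [dist_eq_norm] at e2
  calc ‖x k i - p‖ ≤ ‖x k i - m k‖ + ‖m k - p‖ := norm_sub_le_norm_sub_add_norm_sub ..
    _ ≤ K * r ^ k / c₁ + Q * r ^ k / (1 - r) := add_le_add e1 e2
    _ = _ := by ring

end System
-- The determinant and the conclusion.
lemma det_one_sub_fin_three (a₁₁ a₁₂ a₂₁ a₂₂ a₂₃ a₃₁ a₃₂ a₃₃ : ℝ) :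
    (1 - !![a₁₁, a₁₂, 0; a₂₁, a₂₂, a₂₃; a₃₁, a₃₂, a₃₃] : Matrix (Fin 3) (Fin 3) ℝ).det =
      (1 - a₁₁) * ((1 - a₂₂) * (1 - a₃₃) - a₂₃ * a₃₂)
        - a₁₂ * (a₂₁ * (1 - a₃₃) + a₂₃ * a₃₁) := by
  rw [Matrix.det_fin_three]
  simp
  ring

/-- Expansion along the third column: `(1 - a₃₃)` times this minor is the determinant plus
nonnegative terms. -/
lemma leading_minor_pos {a₁₁ a₁₂ a₂₁ a₂₂ a₂₃ a₃₁ a₃₂ a₃₃ : ℝ} (h₁₂ : 0 ≤ a₁₂)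
    (h₂₃ : 0 ≤ a₂₃) (h₃₁ : 0 ≤ a₃₁) (h₃₂ : 0 ≤ a₃₂)
    (h₁₁ : a₁₁ < 1) (h₃₃ : a₃₃ < 1)
    (hdet : 0 < (1 - a₁₁) * ((1 - a₂₂) * (1 - a₃₃) - a₂₃ * a₃₂)
      - a₁₂ * (a₂₁ * (1 - a₃₃) + a₂₃ * a₃₁)) :
    0 < (1 - a₁₁) * (1 - a₂₂) - a₁₂ * a₂₁ := by
  have h0 : 0 ≤ (1 - a₁₁) * (a₂₃ * a₃₂) := by
    have : 0 ≤ 1 - a₁₁ := by linarith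
    positivity
  have h1 : 0 ≤ a₁₂ * (a₂₃ * a₃₁) := by positivity
  refine pos_of_mul_pos_left (b := 1 - a₃₃) ?_ (by linarith)
  linarith

end DOT

theorem corollary1 {H : Type*} [NormedAddCommGroup H] [InnerProductSpace ℝ H] [CompleteSpace H]
    {N : ℕ} (hN : 0 < N)
    -- the network
    (G : Digraph (Fin N)) (A B : Matrix (Fin N) (Fin N) ℝ) (π ν : Fin N → ℝ)
    (hnet : DOT.IsNetwork G A B π ν)
    -- the local operators are Lipschitz
    (F : Fin N → H → H) (L : Fin N → ℝ≥0) (hL : ∀ i, LipschitzWith (L i) (F i))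
    -- the global operator is quasi-nonexpansive and linearly regular, with a fixed point
    (hF : DOT.QuasiNonexpansive (DOT.globalOp F))
    (hFix : (Function.fixedPoints (DOT.globalOp F)).Nonempty)
    (κ : ℝ) (hκ : 0 < κ) (hreg : DOT.LinearlyRegularWith κ (DOT.globalOp F))
    -- the local operators are quasi-nonexpansive and have a common fixed point
    (hFi : ∀ i, DOT.QuasiNonexpansive (F i))
    (hcommon : (⋂ i, Function.fixedPoints (F i)).Nonempty)
    -- the stepsize: `α < 1 - δ`, and `α` is below every positive root of `det (I - M(β))`
    (c₁ c₂ c₃ c₄ : ℝ) (hc : DOT.NormConstants π ν c₁ c₂ c₃ c₄)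
    (δ : ℝ) (hδ₀ : 0 < δ) (hδ₁ : δ < 1)
    (α : ℝ) (hα₀ : 0 < α) (hα₁ : α < 1 - δ)
    (hα₂ : ∀ β : ℝ, 0 < β →
      (1 - DOT.stepMatrix A B π ν L κ δ c₁ c₂ c₃ c₄ β).det = 0 → α < β) :
    ∃ r : ℝ, 0 < r ∧ r < 1 ∧
      ∀ x y : ℕ → Fin N → H, DOT.IsDOTSequence A B ν F α x y →
        ∃ p ∈ ⋂ i, Function.fixedPoints (F i),
          ∃ C : ℝ, ∀ (k : ℕ) (i : Fin N), ‖x k i - p‖ ≤ C * r ^ k := by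
  have p1 := hc.pos₁
  have p2 := hc.pos₂
  have p3 := hc.pos₃
  obtain ⟨Lb, hLb⟩ : ∃ Lb, Lb = ((Finset.univ.sup L : ℝ≥0) : ℝ) := ⟨_, rfl⟩
  obtain ⟨θ₁, hθ₁⟩ : ∃ θ, θ = c₄ * DOT.l2Norm ((Matrix.diagonal ν)⁻¹) / N := ⟨_, rfl⟩
  obtain ⟨θ₂, hθ₂⟩ : ∃ θ, θ = c₂ * Lb * (√N + 1) / (c₁ * c₃) := ⟨_, rfl⟩
  have hLb0 : 0 ≤ Lb := hLb ▸ NNReal.coe_nonneg _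
  have hθ₁0 : 0 ≤ θ₁ := by
    rw [hθ₁]
    exact div_nonneg (mul_nonneg hc.pos₄.le (norm_nonneg _)) (Nat.cast_nonneg _)
  have hθ₂0 : 0 ≤ θ₂ := by rw [hθ₂]; positivity
  have hρ₁ := hnet.inducedNorm_row_lt_one hN
  have hρ₂ := hnet.inducedNorm_col_lt_one hN
  have rows₁ := fun (x y : ℕ → Fin N → H) (hs : DOT.IsDOTSequence A B ν F α x y) =>
    hs.consensus_le hnet hN hc hα₀.le (by linarith)
  have rows₂ := fun (x y : ℕ → Fin N → H) (hs : DOT.IsDOTSequence A B ν F α x y) =>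
    hs.tracking_le hnet hN hL hF hFix hc hα₀.le hLb hθ₁ hθ₂
  have rows₃ := fun (x y : ℕ → Fin N → H) (hs : DOT.IsDOTSequence A B ν F α x y) =>
    hs.dist_le hnet hN hL hF hFix hc hκ hreg hδ₀ hα₀ hα₁ hLb hθ₁
  simp only [DOT.stepMatrix, DOT.det_one_sub_fin_three, ← hLb, ← hθ₁, ← hθ₂] at hα₂
  simp only [← hθ₁] at rows₁
  have hρ₁0 : 0 ≤ DOT.inducedNorm (DOT.piNorm π) (A - DOT.Ainf π) := DOT.inducedNorm_nonneg _ _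
  have hρ₂0 : 0 ≤ DOT.inducedNorm (DOT.nuNorm ν) (B - DOT.Binf ν) := DOT.inducedNorm_nonneg _ _
  have hθ₄0 : 0 ≤ DOT.l2Norm (A - 1) := norm_nonneg _
  generalize DOT.inducedNorm (DOT.piNorm π) (A - DOT.Ainf π) = ρ₁ at *
  generalize DOT.inducedNorm (DOT.nuNorm ν) (B - DOT.Binf ν) = ρ₂ at *
  generalize DOT.l2Norm (A - 1) = θ₄ at *
  have hdet := DOT.stepDet_pos (p₁ := c₂ * θ₁) (q₀ := θ₂ * θ₄) (q₁ := θ₂ * (ρ₁ + Lb))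
    (p₂ := θ₁ * θ₂) (p₂₃ := 2 * c₁ * θ₂) (p₃₁ := Lb / c₁) (p₃₂ := √N * θ₁ / c₁)
    (g := δ / (4 * κ ^ 2)) hρ₁ hρ₂ (by positivity) hα₀
    (fun b hb h0 => hα₂ b hb (by rw [← h0]; ring))
  have hdet' : 0 < (1 - (1 - α) * ρ₁) * ((1 - (ρ₂ + α * θ₁ * θ₂)) *
      (1 - (1 - δ * α / (4 * κ ^ 2))) - 2 * α * c₁ * θ₂ * (α * √N * θ₁ / c₁)) -
      α * c₂ * θ₁ * (θ₂ * (α * (ρ₁ + Lb) + θ₄) * (1 - (1 - δ * α / (4 * κ ^ 2))) +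
        2 * α * c₁ * θ₂ * (α * Lb / c₁)) := by
    refine hdet.trans_eq ?_
    ring
  have n₁₁ : 0 ≤ (1 - α) * ρ₁ := mul_nonneg (by linarith) hρ₁0
  have n₁₂ : 0 ≤ α * c₂ * θ₁ := by positivity
  have n₂₁ : 0 ≤ θ₂ * (α * (ρ₁ + Lb) + θ₄) := by positivity
  have n₂₂ : 0 ≤ ρ₂ + α * θ₁ * θ₂ := by positivity
  have n₂₃ : 0 ≤ 2 * α * c₁ * θ₂ := by positivity
  have n₃₁ : 0 ≤ α * Lb / c₁ := by positivity
  have n₃₂ : 0 ≤ α * √N * θ₁ / c₁ := by positivity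
  have l₁₁ : (1 - α) * ρ₁ < 1 := by nlinarith
  have l₃₃ : 1 - δ * α / (4 * κ ^ 2) < 1 := sub_lt_self _ (by positivity)
  have hsq : 0 ≤ √(N : ℝ) := Real.sqrt_nonneg _
  have hcommonFix := DOT.fixedPoints_globalOp hN hFi hcommon
  -- The third row is kept general because the corner entry of `stepMatrix` may be negative, in
  -- which case a zero row replaces it.
  have finish : ∀ a₃₁ a₃₂ a₃₃ : ℝ, 0 ≤ a₃₁ → 0 ≤ a₃₂ → 0 ≤ a₃₃ → a₃₃ < 1 →
      0 < (1 - (1 - α) * ρ₁) * ((1 - (ρ₂ + α * θ₁ * θ₂)) * (1 - a₃₃) -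
        2 * α * c₁ * θ₂ * a₃₂) - α * c₂ * θ₁ * (θ₂ * (α * (ρ₁ + Lb) + θ₄) * (1 - a₃₃) +
        2 * α * c₁ * θ₂ * a₃₁) →
      (∀ x y : ℕ → Fin N → H, DOT.IsDOTSequence A B ν F α x y → ∀ k,
        √N * Metric.infDist (∑ j, π j • x (k + 1) j) (Function.fixedPoints (DOT.globalOp F)) ≤
        a₃₁ * DOT.wnorm π (DOT.consensusError π (x k)) +
        a₃₂ * ((√N + 1) * DOT.wnorm (fun i => (ν i)⁻¹) (DOT.trackingError ν (y k))) +
        a₃₃ * (√N *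
          Metric.infDist (∑ j, π j • x k j) (Function.fixedPoints (DOT.globalOp F)))) →
      ∃ r : ℝ, 0 < r ∧ r < 1 ∧
      ∀ x y : ℕ → Fin N → H, DOT.IsDOTSequence A B ν F α x y →
        ∃ p ∈ ⋂ i, Function.fixedPoints (F i),
          ∃ C : ℝ, ∀ (k : ℕ) (i : Fin N), ‖x k i - p‖ ≤ C * r ^ k := by
    intro a₃₁ a₃₂ a₃₃ h₃₁ h₃₂ h₃₃ h₃₃' hd hrow
    -- The rate comes from the matrix alone, before any sequence is introduced, hence its
    -- independence of the initial points.
    obtain ⟨w₁, w₂, w₃, r, hw₁, hw₂, hw₃, hr₀, hr₁, r₁, r₂, r₃⟩ :=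
      DOT.exists_pos_contracted_vector n₁₂ n₂₁ n₂₃ h₃₁ h₃₂ l₁₁ h₃₃' hd
    refine ⟨r, hr₀, hr₁, fun x y hs => ?_⟩
    obtain ⟨K, hK⟩ := DOT.exists_geometric_bound
      (s := fun k => DOT.wnorm π (DOT.consensusError π (x k)))
      (t := fun k => (√N + 1) * DOT.wnorm (fun i => (ν i)⁻¹) (DOT.trackingError ν (y k)))
      (d := fun k => √N *
        Metric.infDist (∑ j, π j • x k j) (Function.fixedPoints (DOT.globalOp F)))
      n₁₁ n₁₂ n₂₁ n₂₂ n₂₃ h₃₁ h₃₂ h₃₃ hw₁ hw₂ hw₃ hr₀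
      r₁ r₂ r₃ (DOT.wnorm_nonneg _ _) (mul_nonneg (by linarith) (DOT.wnorm_nonneg _ _))
      (mul_nonneg hsq Metric.infDist_nonneg) (rows₁ x y hs) (rows₂ x y hs) (hrow x y hs)
    obtain ⟨p, hp, hC⟩ := hs.exists_limit hnet hN hL hF hFix hc hα₀.le hr₀ hr₁ hK
    exact ⟨p, hcommonFix hp, hC⟩
  rcases le_or_gt 0 (1 - δ * α / (4 * κ ^ 2)) with h₃₃ | h₃₃
  · exact finish _ _ _ n₃₁ n₃₂ h₃₃ l₃₃ hdet' rows₃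
  · -- a negative entry forces every point to be fixed, and the third error vanishes
    have hzero : ∀ z : H, Metric.infDist z (Function.fixedPoints (DOT.globalOp F)) = 0 := fun z =>
      le_antisymm (by
        by_contra! hpos
        have := hF.infDist_relax_le hFix hκ hreg hα₀ hδ₀ hα₁ z
        linarith [mul_neg_of_neg_of_pos h₃₃ hpos, Metric.infDist_nonneg
          (x := (1 - α) • z + α • DOT.globalOp F z)
          (s := Function.fixedPoints (DOT.globalOp F))]) Metric.infDist_nonneg
    refine finish 0 0 0 le_rfl le_rfl le_rfl zero_lt_one ?_ fun x y _ k => ?_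
    · have := DOT.leading_minor_pos n₁₂ n₂₃ n₃₁ n₃₂ l₁₁ l₃₃ hdet'
      simpa using this
    · simp [hzero]
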